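/- Let $(R,\mu)$ be a $\sigma$-finite nonatomic measure space, and let $1<p<\infty$ and $p<s\le\infty$. For a measurable function $f:R\to\mathbb{R}$ let $f^*(t)=\inf\{\lambda\ge 0:\mu\{|f|>\lambda\}\le t\}$ be its non-increasing rearrangement and, for $0<q<\infty$ and $0<r\le\infty$, put $$\|f\|_{q,r}=\Big(\int_0^\infty \big(t^{1/q}f^*(t)\big)^r\,\frac{dt}{t}\Big)^{1/r}\quad(r<\infty),\qquad \|f\|_{q,\infty}=\sup_{t>0}t^{1/q}f^*(t);$$ $L^{q,r}(R,\mu)$ is the set of those $f$ with $\|f\|_{q,r}<\infty$. Let $p'$ and $s'$ be the conjugate exponents, $1/p+1/p'=1/s+1/s'=1$, and let $$\|f\|'_{p,s}=\sup\Big\{\int_R fg\,d\mu:\ g\in L^{p',s'}(R,\mu),\ \|g\|_{p',s'}=1\Big\}$$ be the dual norm (the supremum of the empty set being $0$, which matters only if $\mu=0$). Put $$c_{p,s}=\Big(\frac ps\Big)^{1/s}\Big(\frac{p'}{s'}\Big)^{1/s'},$$ where $(p/s)^{1/s}=1$ for $s=\infty$, so that $c_{p,\infty}=p'$. Then $$\|f\|_{p,s}\le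 c_{p,s}\,\|f\|'_{p,s}\qquad\text{for every } f\in L^{p,s}(R,\mu).$$ The constant $c_{p,s}$ is optimal: if $\mu\neq 0$ and $C\in[0,\infty]$ is such that $\|f\|_{p,s}\le C\|f\|'_{p,s}$ for every $f\in L^{p,s}(R,\mu)$, then $C\ge c_{p,s}$. Moreover, on $\mathbb{R}_+=(0,\infty)$ with Lebesgue measure the function $\chi_{[0,1]}$ belongs to $L^{p,s}$, has $\|\chi_{[0,1]}\|_{p,s}>0$, and satisfies $\|\chi_{[0,1]}\|_{p,s}=c_{p,s}\|\chi_{[0,1]}\|'_{p,s}$. -/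

import Mathlib

open MeasureTheory
open scoped ENNReal

universe u

noncomputable section

namespace LorentzSpace

variable {R : Type*} [MeasurableSpace R]

/-- A measure is nonatomic if every measurable set of positive measure contains a measurable
subset of positive, strictly smaller measure. (This is not Mathlib's `NoAtoms`, which only says
that points are null sets.) -/
def IsNonatomic (μ : Measure R) : Prop :=
  ∀ A : Set R, MeasurableSet A → 0 < μ A →
    ∃ B : Set R, B ⊆ A ∧ MeasurableSet B ∧ 0 < μ B ∧ μ B < μ A

/-- The non-increasing rearrangement `f*(t) = inf {l ≥ 0 : μ {|f| > l} ≤ t}`. -/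
def rearrangement (f : R → ℝ) (μ : Measure R) (t : ℝ≥0∞) : ℝ≥0∞ :=
  sInf {l : ℝ≥0∞ | μ {x | l < ‖f x‖ₑ} ≤ t}

/-- The Lorentz functional `‖f‖_{p,s} = (∫₀^∞ (t^{1/p} f*(t))^s dt/t)^{1/s}`, and
`‖f‖_{p,∞} = sup_{t > 0} t^{1/p} f*(t)`. -/
def lorentzNorm (f : R → ℝ) (p s : ℝ≥0∞) (μ : Measure R) : ℝ≥0∞ :=
  if s = ∞ then
    ⨆ (t : ℝ) (_ : 0 < t),
      ENNReal.ofReal t ^ (1 / p).toReal * rearrangement f μ (ENNReal.ofReal t)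
  else
    (∫⁻ t in Set.Ioi (0 : ℝ),
      (ENNReal.ofReal t ^ (1 / p).toReal * rearrangement f μ (ENNReal.ofReal t)) ^ s.toReal
        / ENNReal.ofReal t) ^ (1 / s).toReal

/-- Membership in the Lorentz space `L^{p,s}(R, μ)`. -/
def MemLorentz (f : R → ℝ) (p s : ℝ≥0∞) (μ : Measure R) : Prop :=
  AEStronglyMeasurable f μ ∧ lorentzNorm f p s μ < ∞

/-- The dual norm `‖f‖'_{p,s} = sup {∫ f g dμ : g ∈ L^{p',s'}, ‖g‖_{p',s'} = 1}`, where `p'` and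
`s'` are the conjugate exponents. The set of admissible `g` is stable under `g ↦ -g`, so cutting
the integrals off at `0` does not change the supremum (which is `0` if no `g` is admissible). -/
def dualNorm (f : R → ℝ) (p s : ℝ≥0∞) (μ : Measure R) : ℝ≥0∞ :=
  ⨆ (g : R → ℝ) (_ : MemLorentz g p.conjExponent s.conjExponent μ)
    (_ : lorentzNorm g p.conjExponent s.conjExponent μ = 1), ENNReal.ofReal (∫ x, f x * g x ∂μ)

/-- The constant `c_{p,s} = (p/s)^{1/s} (p'/s')^{1/s'}`; for `s = ∞` (so `s' = 1`) the first factor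
is `0 ^ 0 = 1` and the constant is `p'`. -/
def lorentzConst (p s : ℝ≥0∞) : ℝ≥0∞ :=
  (p / s) ^ (1 / s).toReal *
    (p.conjExponent / s.conjExponent) ^ (1 / s.conjExponent).toReal

end LorentzSpace

end

namespace LorentzSpace

/-! The inequality is a reverse Hölder inequality for a well-chosen test function. For finite `s`,
the Hölder extremal has rearrangement `t^(s/p-1) f*(t)^(s-1)`; since `s > p`, this need not
decrease. It is replaced by its least decreasing majorant `M^(s-1)`, where `M(t) = sup_{y ≥ t}
y^(1-s'/p') f*(y)`. In the variable `u = t^(s'/p')`, `s ∫ f* M^(s-1) dt ≥ (s-1) ∫ M^s du + ∫ f*^s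
d(t^(s/p))`, and weighted AM-GM bounds the right side below by `s` times the product of `(∫ f*^s
d(t^(s/p)))^(1/s)` and `(∫ M^s du)^(1/s')`. With `g* = M^(s-1)` the two integrals are `(s/p) ‖f‖^s`
and `(s'/p') ‖g‖^s'`, so this says `∫ f g ≥ ‖f‖ ‖g‖ / c_{p,s}`.

When only finitely many levels occur, all integrals are finite sums (`sum_young_le`), and `g` is the
sign of `f` times a function of the level index (`lorentzNorm_level_le_dualNorm`). Dyadic
truncations of `|f|` then give the general case by monotone convergence. For `s = ∞`, normalised
indicators of parts of `{|f| > y}` suffice.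

Equality holds for the indicator of any set `E` of finite positive measure: `setLIntegral_enorm_le`
bounds its dual norm, because a decreasing function has a larger mean against a law on `(0, μ E)`
concentrated near `0` than against the uniform one. -/

/-! ### A discrete reverse Hölder inequality. -/

/-- Young's inequality in tangent-line form. -/
lemma rpow_tangent_le {s x y : ℝ} (hs : 1 < s) (hx : 0 ≤ x) (hy : 0 ≤ y) :
    s * (x * y ^ (s - 1)) ≤ (s - 1) * y ^ s + x ^ s := by
  have hc : s.HolderConjugate (s / (s - 1)) := Real.HolderConjugate.conjExponent hs
  have h := Real.young_inequality_of_nonneg hx (Real.rpow_nonneg hy (s - 1)) hc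
  have h0 : s - 1 ≠ 0 := by linarith
  have hs0 : 0 < s := by linarith
  rw [← Real.rpow_mul hy, mul_div_cancel₀ _ h0] at h
  have h2 := mul_le_mul_of_nonneg_left h hs0.le
  calc _ ≤ _ := h2
    _ = _ := by field_simp; ring

/-- On `[0, M]` the function `h ↦ s h M ^ (s - 1) - h ^ s` is increasing. -/
lemma sub_rpow_mono {s x y M : ℝ} (hs : 1 < s) (hx : 0 ≤ x) (hxy : x ≤ y) (hyM : y ≤ M) :
    s * (x * M ^ (s - 1)) - x ^ s ≤ s * (y * M ^ (s - 1)) - y ^ s := by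
  have hy : 0 ≤ y := hx.trans hxy
  have h1 := rpow_tangent_le hs hx hy
  have h2 : y ^ s = y * y ^ (s - 1) := by
    rw [← Real.rpow_one_add' hy (by linarith)]; congr 1; ring
  have h3 : y ^ (s - 1) ≤ M ^ (s - 1) := Real.rpow_le_rpow hy hyM (by linarith)
  have h4 : s * ((y - x) * y ^ (s - 1)) ≤ s * ((y - x) * M ^ (s - 1)) := by
    have : 0 ≤ y - x := by linarith
    gcongr
  rw [h2] at h1 ⊢
  linarith

/-- The running maximum of `c (k + 1) * u k ^ a`. -/
noncomputable def runMax (a : ℝ) (c u : ℕ → ℝ) : ℕ → ℝ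
  | 0 => 0
  | k + 1 => max (runMax a c u k) (c (k + 1) * u k ^ a)

lemma runMax_nonneg (a : ℝ) (c u : ℕ → ℝ) (k : ℕ) : 0 ≤ runMax a c u k := by
  induction k with
  | zero => exact le_rfl
  | succ k ih => exact ih.trans (le_max_left _ _)

lemma runMax_mono (a : ℝ) (c u : ℕ → ℝ) : Monotone (runMax a c u) :=
  monotone_nat_of_le_succ fun _ => le_max_left _ _

/-- The potential whose increments compare the three sums in `sum_young_le`. -/
noncomputable def potential (s a u c M : ℝ) : ℝ :=
  s * (c * M ^ (s - 1) * u ^ (1 + a)) - (s - 1) * (M ^ s * u) - c ^ s * u ^ (a * s + 1)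

lemma potential_eq {s a u c M : ℝ} (hs : 1 < s) (ha : 0 ≤ a) (hu : 0 ≤ u) (hc : 0 ≤ c) :
    potential s a u c M =
      u * (s * (c * u ^ a * M ^ (s - 1)) - (s - 1) * M ^ s - (c * u ^ a) ^ s) := by
  have has : 0 ≤ a * s := mul_nonneg ha (by linarith)
  rw [potential, Real.rpow_one_add' hu (by linarith), add_comm (a * s),
    Real.rpow_one_add' hu (by linarith), Real.mul_rpow hc (Real.rpow_nonneg hu a),
    ← Real.rpow_mul hu]
  ring

/-- Put `h = c * u ^ a`. If the maximum is replaced by `d * u ^ a`, the new potential is `0` and the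
old one is at most `0` by Young; otherwise `M` stays and `h` grows within `[0, M]`, where the
potential increases. -/
lemma potential_step {s a u c d M : ℝ} (hs : 1 < s) (ha : 0 ≤ a) (hu : 0 ≤ u) (hc : 0 ≤ c)
    (hcd : c ≤ d) (hM : 0 ≤ M) :
    potential s a u c M ≤ potential s a u d (max M (d * u ^ a)) := by
  have hd : 0 ≤ d := hc.trans hcd
  have hua : 0 ≤ u ^ a := Real.rpow_nonneg hu a
  rw [potential_eq hs ha hu hc, potential_eq hs ha hu hd]
  refine mul_le_mul_of_nonneg_left ?_ hu
  have hxy : c * u ^ a ≤ d * u ^ a := mul_le_mul_of_nonneg_right hcd hua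
  have hx : 0 ≤ c * u ^ a := mul_nonneg hc hua
  rcases le_total M (d * u ^ a) with h | h
  · rw [max_eq_right h]
    have h1 := rpow_tangent_le hs hx hM
    have h2 : (d * u ^ a) ^ s = d * u ^ a * (d * u ^ a) ^ (s - 1) := by
      rw [← Real.rpow_one_add' (hx.trans hxy) (by linarith)]; congr 1; ring
    rw [h2]
    linarith
  · rw [max_eq_left h]
    have := sub_rpow_mono hs hx hxy h
    linarith

/-- The difference of the two sides is a sum of changes of the potential in `u` with `c`, `M` fixed.
By `potential_step` the changes in `c`, `M` with `u` fixed are nonnegative, so adding them to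
complete a telescoping sum only helps. -/
lemma sum_young_le {s a : ℝ} (hs : 1 < s) (ha : 0 ≤ a) {c u : ℕ → ℝ} (hc : Monotone c)
    (hc0 : c 0 = 0) (hu : ∀ k, 0 ≤ u k) {n : ℕ} (hun : u n = 0) :
    (s - 1) * ∑ k ∈ Finset.range n, runMax a c u (k + 1) ^ s * (u k - u (k + 1)) +
      ∑ k ∈ Finset.range n, c (k + 1) ^ s * (u k ^ (a * s + 1) - u (k + 1) ^ (a * s + 1)) ≤
    s * ∑ k ∈ Finset.range n,
      c (k + 1) * runMax a c u (k + 1) ^ (s - 1) * (u k ^ (1 + a) - u (k + 1) ^ (1 + a)) := by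
  have hcn : ∀ k, 0 ≤ c k := fun k => hc0 ▸ hc (Nat.zero_le k)
  have has : 0 ≤ a * s := mul_nonneg ha (by linarith)
  have h1 : ∀ k ∈ Finset.range n,
      potential s a (u k) (c k) (runMax a c u k) -
        potential s a (u (k + 1)) (c (k + 1)) (runMax a c u (k + 1)) ≤
      potential s a (u k) (c (k + 1)) (runMax a c u (k + 1)) -
        potential s a (u (k + 1)) (c (k + 1)) (runMax a c u (k + 1)) := fun k _ =>
    sub_le_sub_right
      (potential_step hs ha (hu k) (hcn k) (hc k.le_succ) (runMax_nonneg a c u k)) _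
  have h2 := Finset.sum_le_sum h1
  rw [Finset.sum_range_sub'] at h2
  -- The telescoped sum vanishes: `c` and `M` start at `0`, and `u` ends at `0`.
  have h3 : potential s a (u 0) (c 0) (runMax a c u 0) = 0 := by
    have : (0 : ℝ) ^ s = 0 := Real.zero_rpow (by linarith)
    simp [potential, hc0, runMax, this]
  have h4 : potential s a (u n) (c n) (runMax a c u n) = 0 := by
    have h5 : (0 : ℝ) ^ (1 + a) = 0 := Real.zero_rpow (by linarith)
    have h6 : (0 : ℝ) ^ (a * s + 1) = 0 := Real.zero_rpow (by linarith)
    simp [potential, hun, h5, h6]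
  rw [h3, h4, sub_zero] at h2
  rw [← sub_nonneg]
  refine h2.trans_eq ?_
  rw [Finset.mul_sum, Finset.mul_sum, ← Finset.sum_add_distrib, ← Finset.sum_sub_distrib]
  refine Finset.sum_congr rfl fun k _ => ?_
  simp only [potential]
  ring

/-- The multiplicative form of `sum_young_le`. -/
lemma rpow_mul_rpow_le_sum {s s' a : ℝ} (hss : s.HolderConjugate s') (ha : 0 ≤ a)
    {c u : ℕ → ℝ} (hc : Monotone c) (hc0 : c 0 = 0) (hu : ∀ k, 0 ≤ u k) (hua : Antitone u)
    {n : ℕ} (hun : u n = 0) :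
    (∑ k ∈ Finset.range n, c (k + 1) ^ s * (u k ^ (a * s + 1) - u (k + 1) ^ (a * s + 1))) ^
        (1 / s) *
      (∑ k ∈ Finset.range n, runMax a c u (k + 1) ^ s * (u k - u (k + 1))) ^ (1 / s') ≤
    ∑ k ∈ Finset.range n,
      c (k + 1) * runMax a c u (k + 1) ^ (s - 1) * (u k ^ (1 + a) - u (k + 1) ^ (1 + a)) := by
  have hs := hss.lt
  have hcn : ∀ k, 0 ≤ c k := fun k => hc0 ▸ hc (Nat.zero_le k)
  have has : 0 ≤ a * s := mul_nonneg ha (by linarith)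
  have h := sum_young_le hs ha hc hc0 hu hun
  set T := ∑ k ∈ Finset.range n, runMax a c u (k + 1) ^ s * (u k - u (k + 1))
  set Y := ∑ k ∈ Finset.range n, c (k + 1) ^ s * (u k ^ (a * s + 1) - u (k + 1) ^ (a * s + 1))
  have hT : 0 ≤ T := Finset.sum_nonneg fun k _ => mul_nonneg
    (Real.rpow_nonneg (runMax_nonneg a c u _) _) (sub_nonneg.2 (hua k.le_succ))
  have hY : 0 ≤ Y := Finset.sum_nonneg fun k _ => mul_nonneg
    (Real.rpow_nonneg (hcn _) _) (sub_nonneg.2 (Real.rpow_le_rpow (hu _) (hua k.le_succ)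
      (by linarith)))
  -- Divided by `s`, the additive inequality bounds exactly the mean with weights `1 / s` and `1 /
  -- s'`.
  have hy := Real.geom_mean_le_arith_mean2_weighted (w₁ := 1 / s) (w₂ := 1 / s')
    (p₁ := Y) (p₂ := T) (by have := hss.pos; positivity) (by have := hss.symm.pos; positivity)
    hY hT (by simpa using hss.inv_add_inv_eq_one)
  refine hy.trans ?_
  have h1 : 1 / s' = (s - 1) / s := by
    have := hss.inv_add_inv_eq_one
    have h0 := hss.pos.ne'
    rw [one_div, sub_div, div_self h0, one_div]; linarith
  rw [h1, div_mul_eq_mul_div, div_mul_eq_mul_div, ← add_div, div_le_iff₀ hss.pos]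
  linarith

/-! ### Rearrangements and Lorentz functionals of functions with finitely many levels. -/

section

variable {R : Type*} [MeasurableSpace R] {μ : Measure R}

lemma rearrangement_mono {f g : R → ℝ} (h : ∀ᵐ x ∂μ, ‖f x‖ₑ ≤ ‖g x‖ₑ) (t : ℝ≥0∞) :
    rearrangement f μ t ≤ rearrangement g μ t := by
  refine sInf_le_sInf fun l (hl : μ _ ≤ t) => (measure_mono_ae ?_).trans hl
  filter_upwards [h] with x hx (hlx : l < _) using hlx.trans_le hx

lemma rearrangement_anti (f : R → ℝ) : Antitone (rearrangement f μ) := fun _ _ h =>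
  sInf_le_sInf fun _ (hl : μ _ ≤ _) => le_trans hl h

/-- The infimum defining `f*` is attained, because `{|f| > v}` increases to `{|f| > l}` as `v`
decreases to `l`. -/
lemma lt_rearrangement_iff {f : R → ℝ} {l t : ℝ≥0∞} :
    l < rearrangement f μ t ↔ t < μ {x | l < ‖f x‖ₑ} := by
  refine ⟨fun h => not_le.1 fun h' => h.not_ge (sInf_le h'), fun h => ?_⟩
  have hl : l < ∞ := by
    refine lt_top_iff_ne_top.2 fun hl => ?_
    simp [hl] at h
  obtain ⟨v, hv, hvl, hlim⟩ := exists_seq_strictAnti_tendsto' hl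
  have hU : {x | l < ‖f x‖ₑ} = ⋃ n, {x | v n < ‖f x‖ₑ} := by
    ext x
    simp only [Set.mem_ofPred_eq, Set.mem_iUnion]
    refine ⟨fun hx => ((hlim.eventually (gt_mem_nhds hx)).exists), fun ⟨n, hn⟩ => ?_⟩
    exact (hvl n).1.trans hn
  have hm : Monotone fun n => {x | v n < ‖f x‖ₑ} := fun m n hmn x (hx : v m < _) =>
    (hv.antitone hmn).trans_lt hx
  rw [hU, hm.measure_iUnion, lt_iSup_iff] at h
  obtain ⟨n, hn⟩ := h
  refine (hvl n).1.trans_le (le_sInf fun m (hm : μ _ ≤ t) => ?_)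
  by_contra! hlt
  exact (hn.trans_le ((measure_mono fun x (hx : v n < _) => hlt.trans hx).trans hm)).false

lemma lorentzNorm_of_ne_top (f : R → ℝ) (p : ℝ≥0∞) {s : ℝ≥0∞} (hs : s ≠ ∞) :
    lorentzNorm f p s μ =
      (∫⁻ t in Set.Ioi (0 : ℝ), ENNReal.ofReal (t ^ (s.toReal / p.toReal - 1)) *
        rearrangement f μ (ENNReal.ofReal t) ^ s.toReal) ^ (1 / s.toReal) := by
  rw [lorentzNorm, if_neg hs]
  congr 1
  · refine setLIntegral_congr_fun measurableSet_Ioi fun t (ht : 0 < t) => ?_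
    rw [ENNReal.mul_rpow_of_nonneg _ _ ENNReal.toReal_nonneg, ENNReal.ofReal_rpow_of_pos ht,
      ENNReal.ofReal_rpow_of_pos (Real.rpow_pos_of_pos ht _), ← Real.rpow_mul ht.le,
      mul_comm, mul_div_assoc, ← ENNReal.ofReal_div_of_pos ht, mul_comm,
      Real.rpow_sub ht, Real.rpow_one, one_div, ENNReal.toReal_inv, inv_mul_eq_div]
  · rw [one_div, ENNReal.toReal_inv, one_div]

lemma lorentzNorm_top (f : R → ℝ) (p : ℝ≥0∞) :
    lorentzNorm f p ∞ μ = ⨆ (t : ℝ) (_ : 0 < t),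
      ENNReal.ofReal (t ^ (1 / p.toReal)) * rearrangement f μ (ENNReal.ofReal t) := by
  rw [lorentzNorm, if_pos rfl]
  refine iSup_congr fun t => iSup_congr fun ht => ?_
  rw [ENNReal.ofReal_rpow_of_pos ht, one_div, ENNReal.toReal_inv, one_div]

lemma lorentzNorm_mono {f g : R → ℝ} (p s : ℝ≥0∞) (h : ∀ᵐ x ∂μ, ‖f x‖ₑ ≤ ‖g x‖ₑ) :
    lorentzNorm f p s μ ≤ lorentzNorm g p s μ := by
  have hr := fun t => rearrangement_mono h t
  by_cases hs : s = ∞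
  · subst hs
    rw [lorentzNorm_top, lorentzNorm_top]
    gcongr
    exact hr _
  · rw [lorentzNorm_of_ne_top _ _ hs, lorentzNorm_of_ne_top _ _ hs]
    gcongr
    exact hr _

lemma lorentzNorm_congr {f g : R → ℝ} (p s : ℝ≥0∞) (h : f =ᵐ[μ] g) :
    lorentzNorm f p s μ = lorentzNorm g p s μ :=
  le_antisymm (lorentzNorm_mono p s (h.mono fun x hx => by rw [hx]))
    (lorentzNorm_mono p s (h.mono fun x hx => by rw [hx]))

lemma setLIntegral_Ico_rpow {b x y : ℝ} (hb : 0 < b) (hxy : x ≤ y) :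
    ∫⁻ t in Set.Ico x y ∩ Set.Ioi 0, ENNReal.ofReal (t ^ (b - 1)) =
      ENNReal.ofReal ((max y 0 ^ b - max x 0 ^ b) / b) := by
  have h0 : (Set.Ico x y ∩ Set.Ioi 0 : Set ℝ) =ᵐ[volume] Set.Ioc (max x 0) (max y 0) := by
    have h1 : (Set.Ico x y ∩ Set.Ioi 0 : Set ℝ) =ᵐ[volume] (Set.Ioc x y ∩ Set.Ioi 0 : Set ℝ) :=
      Ico_ae_eq_Ioc.inter (ae_eq_refl _)
    refine h1.trans (Filter.Eventually.of_forall fun t => ?_)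
    refine propext (?_ : t ∈ Set.Ioc x y ∩ Set.Ioi 0 ↔ t ∈ Set.Ioc (max x 0) (max y 0))
    simp only [Set.mem_inter_iff, Set.mem_Ioc, Set.mem_Ioi, max_lt_iff, le_max_iff]
    constructor
    · rintro ⟨⟨h1, h2⟩, h3⟩; exact ⟨⟨h1, h3⟩, Or.inl h2⟩
    · rintro ⟨⟨h1, h2⟩, h3 | h3⟩
      · exact ⟨⟨h1, h3⟩, h2⟩
      · exact absurd h2 h3.not_gt
  have hm : max x 0 ≤ max y 0 := max_le_max_right 0 hxy
  rw [setLIntegral_congr h0, ← ofReal_integral_eq_lintegral_ofReal]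
  · rw [← intervalIntegral.integral_of_le hm, integral_rpow (Or.inl (by linarith))]
    simp
  · exact (intervalIntegral.intervalIntegrable_rpow' (by linarith)).1
  · filter_upwards [ae_restrict_mem measurableSet_Ioc] with t ht
    exact Real.rpow_nonneg ((le_max_right x 0).trans ht.1.le) _

/-- The rearrangement of an increasing function of an integer valued function. -/
lemma rearrangement_eq_of_level {f : R → ℝ} {κ : R → ℕ} {c : ℕ → ℝ} (hc : Monotone c)
    (hf : ∀ᵐ x ∂μ, ‖f x‖ₑ = ENNReal.ofReal (c (κ x))) {k : ℕ} {t : ℝ≥0∞}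
    (h1 : μ {x | k < κ x} ≤ t) (h2 : t < μ {x | k ≤ κ x}) :
    rearrangement f μ t = ENNReal.ofReal (c k) := by
  refine le_antisymm (sInf_le ((measure_mono_ae ?_).trans h1))
    (le_sInf fun l (hl : μ _ ≤ t) => ?_)
  · filter_upwards [hf] with x hx (hlt : _ < ‖f x‖ₑ)
    refine (not_le.1 fun h => hlt.not_ge ?_ : k < κ x)
    rw [hx]
    exact ENNReal.ofReal_le_ofReal (hc h)
  · by_contra! hlt
    refine (h2.trans_le (le_trans (measure_mono_ae ?_) hl)).false
    filter_upwards [hf] with x hx (hk : k ≤ κ x)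
    refine (?_ : l < ‖f x‖ₑ)
    rw [hx]
    exact hlt.trans_le (ENNReal.ofReal_le_ofReal (hc hk))

lemma rearrangement_eq_zero {f : R → ℝ} {t : ℝ≥0∞} (h : μ {x | 0 < ‖f x‖ₑ} ≤ t) :
    rearrangement f μ t = 0 :=
  le_antisymm (sInf_le h) bot_le

/-- With `w k = μ {k + 1 ≤ κ}`, the rearrangement is `c (k + 1)` on `[w (k + 1), w k)`, and the
weight `t^(s/p-1)` integrates explicitly there. Only `|f|` is prescribed, so signed test functions
are covered. -/
lemma lorentzNorm_step {f : R → ℝ} {κ : R → ℕ} {c : ℕ → ℝ} {n : ℕ} (hc : Monotone c)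
    (hc0 : c 0 = 0) (hn : ∀ x, κ x ≤ n) (hfin : μ {x | 1 ≤ κ x} ≠ ∞)
    (hf : ∀ᵐ x ∂μ, ‖f x‖ₑ = ENNReal.ofReal (c (κ x)))
    {p s : ℝ≥0∞} (hp : p ≠ ∞) (hp0 : p ≠ 0) (hs : s ≠ ∞) (hs0 : s ≠ 0) :
    lorentzNorm f p s μ = ENNReal.ofReal
      ((p.toReal / s.toReal * ∑ k ∈ Finset.range n, c (k + 1) ^ s.toReal *
        (μ.real {x | k + 1 ≤ κ x} ^ (s.toReal / p.toReal) -
          μ.real {x | k + 1 + 1 ≤ κ x} ^ (s.toReal / p.toReal))) ^ (1 / s.toReal)) := by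
  set P := p.toReal
  set S := s.toReal
  have hP : 0 < P := ENNReal.toReal_pos hp0 hp
  have hS : 0 < S := ENNReal.toReal_pos hs0 hs
  have hb : 0 < S / P := div_pos hS hP
  have hcn : ∀ k, 0 ≤ c k := fun k => hc0 ▸ hc (Nat.zero_le k)
  set w : ℕ → ℝ := fun k => μ.real {x | k + 1 ≤ κ x} with hw
  have hfin' : ∀ k, μ {x | k + 1 ≤ κ x} ≠ ∞ := fun k =>
    measure_ne_top_of_subset (fun x (hx : k + 1 ≤ κ x) => (by omega : 1 ≤ κ x)) hfin
  have hwa : Antitone w := fun i j hij =>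
    measureReal_mono (fun x (hx : j + 1 ≤ κ x) => (by omega : i + 1 ≤ κ x)) (hfin' i)
  have hw0 : ∀ k, 0 ≤ w k := fun k => measureReal_nonneg
  have hwn : w n = 0 := by
    have : {x | n + 1 ≤ κ x} = ∅ := by
      ext x; simpa using Nat.lt_succ_of_le (hn x)
    simp only [hw, this, measureReal_empty]
  have hofw : ∀ k, ENNReal.ofReal (w k) = μ {x | k + 1 ≤ κ x} := fun k =>
    ENNReal.ofReal_toReal (hfin' k)
  rw [lorentzNorm_of_ne_top f p hs]
  have hdiff : ∀ k, 0 ≤ c (k + 1) ^ S * (w k ^ (S / P) - w (k + 1) ^ (S / P)) := fun k =>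
    mul_nonneg (Real.rpow_nonneg (hcn _) _)
      (sub_nonneg.2 (Real.rpow_le_rpow (hw0 _) (hwa k.le_succ) hb.le))
  rw [← ENNReal.ofReal_rpow_of_nonneg (mul_nonneg (div_pos hP hS).le
    (Finset.sum_nonneg fun k _ => hdiff k)) (by positivity)]
  congr 1
  have hpt : ∀ t ∈ Set.Ioi (0 : ℝ), ENNReal.ofReal (t ^ (S / P - 1)) *
      rearrangement f μ (ENNReal.ofReal t) ^ S =
      ∑ k ∈ Finset.range n, (Set.Ico (w (k + 1)) (w k)).indicator
        (fun t => ENNReal.ofReal (c (k + 1) ^ S) * ENNReal.ofReal (t ^ (S / P - 1))) t := by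
    intro t (ht : 0 < t)
    rcases le_or_gt (w 0) t with h | h
    · rw [rearrangement_eq_zero, ENNReal.zero_rpow_of_pos hS, mul_zero, Finset.sum_eq_zero]
      · intro k _
        refine Set.indicator_of_notMem (fun hk => ?_) _
        exact (hk.2.trans_le ((hwa (Nat.zero_le k)).trans h)).false
      · refine (measure_mono_ae ?_).trans ((hofw 0).symm.trans_le (ENNReal.ofReal_le_ofReal h))
        filter_upwards [hf] with x hx (hlt : 0 < ‖f x‖ₑ)
        refine (Nat.pos_of_ne_zero fun h0 => ?_ : 0 < κ x)
        rw [hx, h0, hc0] at hlt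
        simp at hlt
    -- The least index with `w ≤ t` is positive, as `t < w 0`; its predecessor labels the only
    -- interval containing `t`.
    · have hex : ∃ k, w k ≤ t := ⟨n, hwn.trans_le ht.le⟩
      classical
      obtain ⟨k, hk⟩ : ∃ k, Nat.find hex = k + 1 := by
        refine Nat.exists_eq_succ_of_ne_zero fun h0 => ?_
        have := Nat.find_spec hex
        rw [h0] at this
        exact this.not_gt h
      have hk1 : w (k + 1) ≤ t := hk ▸ Nat.find_spec hex
      have hk2 : t < w k := not_le.1 (Nat.find_min hex (by omega))
      have hkn : k < n := by
        by_contra! hle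
        have := hwa hle
        rw [hwn] at this
        exact (ht.trans (hk2.trans_le this)).false
      rw [Finset.sum_eq_single_of_mem k (Finset.mem_range.2 hkn),
        Set.indicator_of_mem (show t ∈ Set.Ico (w (k + 1)) (w k) from ⟨hk1, hk2⟩),
        rearrangement_eq_of_level (k := k + 1) hc hf, mul_comm,
        ENNReal.ofReal_rpow_of_nonneg (hcn _) hS.le]
      · exact (hofw (k + 1)).symm.trans_le (ENNReal.ofReal_le_ofReal hk1)
      · exact ((ENNReal.ofReal_lt_ofReal_iff (ht.trans hk2)).2 hk2).trans_eq (hofw k)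
      · intro j _ hjk
        refine Set.indicator_of_notMem (fun hj => ?_) _
        rcases lt_or_gt_of_ne hjk with hlt | hlt
        · exact (hk2.trans_le ((hwa hlt).trans hj.1)).false
        · exact (hj.2.trans_le ((hwa hlt).trans hk1)).false
  rw [setLIntegral_congr_fun measurableSet_Ioi hpt, lintegral_finsetSum]
  · rw [Finset.mul_sum, ENNReal.ofReal_sum_of_nonneg]
    · refine Finset.sum_congr rfl fun k _ => ?_
      rw [lintegral_indicator measurableSet_Ico, Measure.restrict_restrict measurableSet_Ico,
        lintegral_const_mul _ (by fun_prop), setLIntegral_Ico_rpow hb (hwa k.le_succ),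
        max_eq_left (hw0 _), max_eq_left (hw0 _), ← ENNReal.ofReal_mul
        (Real.rpow_nonneg (hcn _) _)]
      congr 1
      field_simp
    · exact fun k _ => mul_nonneg (div_pos hP hS).le (hdiff k)
  · intro k _
    exact Measurable.indicator (by fun_prop) measurableSet_Ico

end

/-! ### The inequality for finite `s`, at finitely many levels. -/

section

lemma conjExponent_ne_top {p : ℝ≥0∞} (hp : 1 < p) : p.conjExponent ≠ ∞ := by
  simp [ENNReal.conjExponent, ENNReal.inv_eq_top, tsub_eq_zero_iff_le, hp]

lemma conjExponent_ne_zero (p : ℝ≥0∞) : p.conjExponent ≠ 0 := by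
  simp [ENNReal.conjExponent]

lemma conjExponent_top : (∞ : ℝ≥0∞).conjExponent = 1 := by
  simp [ENNReal.conjExponent]

lemma holderConjugate_toReal {p : ℝ≥0∞} (hp : 1 < p) (hp' : p ≠ ∞) :
    p.toReal.HolderConjugate p.conjExponent.toReal := by
  have := ENNReal.HolderConjugate.conjExponent hp.le
  have h1 : 1 < p.toReal := by
    rw [← ENNReal.toReal_one]; exact (ENNReal.toReal_lt_toReal (by simp) hp').2 hp
  exact ENNReal.HolderConjugate.toReal h1

lemma lorentzConst_of_ne_top {p s : ℝ≥0∞} (hp : 1 < p) (hp' : p ≠ ∞) (hs : 1 < s)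
    (hs' : s ≠ ∞) :
    lorentzConst p s = ENNReal.ofReal ((p.toReal / s.toReal) ^ (1 / s.toReal) *
      (p.conjExponent.toReal / s.conjExponent.toReal) ^ (1 / s.conjExponent.toReal)) := by
  have key : ∀ q r : ℝ≥0∞, q ≠ ∞ → q ≠ 0 → r ≠ ∞ → r ≠ 0 → (q / r) ^ (1 / r).toReal =
      ENNReal.ofReal ((q.toReal / r.toReal) ^ (1 / r.toReal)) := by
    intro q r hq hq0 hr hr0
    have hq1 := ENNReal.toReal_pos hq0 hq
    have hr1 := ENNReal.toReal_pos hr0 hr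
    rw [← ENNReal.ofReal_rpow_of_pos (div_pos hq1 hr1), ENNReal.ofReal_div_of_pos hr1,
      ENNReal.ofReal_toReal hq, ENNReal.ofReal_toReal hr, one_div, ENNReal.toReal_inv, one_div]
  rw [lorentzConst, key p s hp' (zero_lt_one.trans hp).ne' hs' (zero_lt_one.trans hs).ne',
    key _ _ (conjExponent_ne_top hp) (conjExponent_ne_zero p) (conjExponent_ne_top hs)
    (conjExponent_ne_zero s), ENNReal.ofReal_mul (by positivity)]

lemma lorentzConst_top (p : ℝ≥0∞) : lorentzConst p ∞ = p.conjExponent := by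
  simp [lorentzConst, conjExponent_top]

variable {R : Type*} [MeasurableSpace R] {μ : Measure R}

lemma lintegral_comp_level {κ : R → ℕ} {d : ℕ → ℝ} {n : ℕ} (hκ : Measurable κ)
    (hn : ∀ x, κ x ≤ n) (hfin : μ {x | 1 ≤ κ x} ≠ ∞) (hd : ∀ k, 0 ≤ d k) (hd0 : d 0 = 0) :
    ∫⁻ x, ENNReal.ofReal (d (κ x)) ∂μ = ENNReal.ofReal (∑ k ∈ Finset.range n,
      d (k + 1) * (μ.real {x | k + 1 ≤ κ x} - μ.real {x | k + 1 + 1 ≤ κ x})) := by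
  have hfin' : ∀ k, μ {x | k + 1 ≤ κ x} ≠ ∞ := fun k =>
    measure_ne_top_of_subset (fun x (hx : k + 1 ≤ κ x) => (by omega : 1 ≤ κ x)) hfin
  have hpt : ∀ x, ENNReal.ofReal (d (κ x)) = ∑ k ∈ Finset.range n,
      (κ ⁻¹' {k + 1}).indicator (fun _ => ENNReal.ofReal (d (k + 1))) x := by
    intro x
    rcases Nat.eq_zero_or_pos (κ x) with h | h
    · rw [h, hd0, ENNReal.ofReal_zero, Finset.sum_eq_zero]
      intro k _
      exact Set.indicator_of_notMem (by simp [h]) _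
    · obtain ⟨j, hj⟩ := Nat.exists_eq_succ_of_ne_zero h.ne'
      have hjn := hn x
      rw [Finset.sum_eq_single_of_mem j (Finset.mem_range.2 (by omega)),
        Set.indicator_of_mem (by simp [hj]), hj]
      intro k _ hk
      exact Set.indicator_of_notMem (by simp [hj, Ne.symm hk]) _
  have hm : ∀ k, MeasurableSet (κ ⁻¹' {k}) := fun k => hκ (measurableSet_singleton k)
  simp_rw [hpt]
  rw [lintegral_finsetSum _ fun k _ => measurable_const.indicator (hm _),
    ENNReal.ofReal_sum_of_nonneg]
  · refine Finset.sum_congr rfl fun k _ => ?_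
    have hsub : {x | k + 1 + 1 ≤ κ x} ⊆ {x | k + 1 ≤ κ x} :=
      fun x (hx : k + 1 + 1 ≤ κ x) => (by omega : k + 1 ≤ κ x)
    have hset : κ ⁻¹' {k + 1} = {x | k + 1 ≤ κ x} \ {x | k + 1 + 1 ≤ κ x} := by
      ext x
      change κ x = k + 1 ↔ k + 1 ≤ κ x ∧ ¬ (k + 1 + 1 ≤ κ x)
      omega
    have hmeas : MeasurableSet {x | k + 1 + 1 ≤ κ x} := hκ measurableSet_Ici
    rw [lintegral_indicator (hm _), setLIntegral_const, ENNReal.ofReal_mul (hd _),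
      ← measureReal_sdiff hsub hmeas (hfin' _), ← hset, measureReal_def,
      ENNReal.ofReal_toReal]
    exact measure_ne_top_of_subset (hset ▸ Set.sdiff_subset) (hfin' k)
  · intro k _
    refine mul_nonneg (hd _) (sub_nonneg.2 (measureReal_mono ?_ (hfin' k)))
    exact fun x (hx : k + 1 + 1 ≤ κ x) => (by omega : k + 1 ≤ κ x)

lemma le_dualNorm {f g : R → ℝ} {p s : ℝ≥0∞} (hg : AEStronglyMeasurable g μ)
    (h1 : lorentzNorm g p.conjExponent s.conjExponent μ = 1) :
    ENNReal.ofReal (∫ x, f x * g x ∂μ) ≤ dualNorm f p s μ := by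
  refine le_iSup₂_of_le g ⟨hg, h1 ▸ ENNReal.one_lt_top⟩ ?_
  exact le_iSup_of_le h1 le_rfl

/-- Testing the dual norm of `f` on `sign f * m ∘ κ`. -/
lemma le_dualNorm_of_level {f : R → ℝ} {κ : R → ℕ} {c m : ℕ → ℝ} {n : ℕ} {B : ℝ}
    (hfm : Measurable f) (hκ : Measurable κ)
    (hn : ∀ x, κ x ≤ n) (hfin : μ {x | 1 ≤ κ x} ≠ ∞) (hc : ∀ k, 0 ≤ c k)
    (hm : Monotone m) (hm0 : m 0 = 0)
    (hcf : ∀ x, c (κ x) ≤ |f x|) (hB : ∀ x, 1 ≤ κ x → |f x| ≤ B) {p s : ℝ≥0∞}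
    (h1 : ∀ g : R → ℝ, (∀ᵐ x ∂μ, ‖g x‖ₑ = ENNReal.ofReal (m (κ x))) →
      lorentzNorm g p.conjExponent s.conjExponent μ = 1) :
    ENNReal.ofReal (∑ k ∈ Finset.range n,
      c (k + 1) * m (k + 1) * (μ.real {x | k + 1 ≤ κ x} - μ.real {x | k + 1 + 1 ≤ κ x})) ≤
      dualNorm f p s μ := by
  have hmn : ∀ k, 0 ≤ m k := fun k => hm0 ▸ hm (Nat.zero_le k)
  set g : R → ℝ := fun x => if 0 ≤ f x then m (κ x) else -m (κ x) with hg
  have hmκ : Measurable fun x => m (κ x) := (measurable_of_countable m).comp hκ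
  have hgm : Measurable g :=
    Measurable.ite (measurableSet_le measurable_const hfm) hmκ hmκ.neg
  have habs : ∀ x, |g x| = m (κ x) := fun x => by
    simp only [hg]
    split_ifs <;> simp [abs_of_nonneg (hmn _)]
  have hfg : ∀ x, f x * g x = |f x| * m (κ x) := fun x => by
    simp only [hg]
    split_ifs with h
    · rw [abs_of_nonneg h]
    · rw [abs_of_neg (not_le.1 h)]; ring
  have hge : ∀ᵐ x ∂μ, ‖g x‖ₑ = ENNReal.ofReal (m (κ x)) := Filter.Eventually.of_forall
    fun x => by rw [← habs, Real.enorm_eq_ofReal_abs]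
  refine le_trans ?_ (le_dualNorm hgm.aestronglyMeasurable (h1 g hge))
  simp_rw [hfg]
  -- Integrability matters, since a divergent Bochner integral would count as `0`. It holds because
  -- the integrand is bounded and lives on `{1 ≤ κ}`, of finite measure.
  have hint : Integrable (fun x => |f x| * m (κ x)) μ := by
    have hS : MeasurableSet {x | 1 ≤ κ x} := hκ measurableSet_Ici
    have : (fun x => |f x| * m (κ x)) =
        {x | 1 ≤ κ x}.indicator fun x => |f x| * m (κ x) := by
      ext x
      by_cases h : 1 ≤ κ x
      · rw [Set.indicator_of_mem (show x ∈ {x | 1 ≤ κ x} from h)]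
      · rw [Set.indicator_of_notMem (show x ∉ {x | 1 ≤ κ x} from h),
          Nat.lt_one_iff.1 (not_le.1 h), hm0, mul_zero]
    rw [this, integrable_indicator_iff hS]
    refine Measure.integrableOn_of_bounded (M := B * m n) hfin
      (hfm.abs.mul hmκ).aestronglyMeasurable ?_
    filter_upwards [ae_restrict_mem hS] with x hx
    rw [Real.norm_of_nonneg (mul_nonneg (abs_nonneg _) (hmn _))]
    exact mul_le_mul (hB x hx) (hm (hn x)) (hmn _) ((abs_nonneg _).trans (hB x hx))
  rw [ofReal_integral_eq_lintegral_ofReal hint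
    (Filter.Eventually.of_forall fun x => mul_nonneg (abs_nonneg _) (hmn _)),
    ← lintegral_comp_level (d := fun k => c k * m k) hκ hn hfin
      (fun k => mul_nonneg (hc k) (hmn k)) (by simp [hm0])]
  exact lintegral_mono fun x => ENNReal.ofReal_le_ofReal
    (mul_le_mul_of_nonneg_right (hcf x) (hmn _))

/-- The test function is paired with `f` itself, which dominates `c ∘ κ`. Hence the right side does
not depend on the discretisation, and only the left side has to pass to the limit. -/
lemma lorentzNorm_level_le_dualNorm {f : R → ℝ} {κ : R → ℕ} {c : ℕ → ℝ} {n : ℕ} {B : ℝ}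
    (hfm : Measurable f) (hκ : Measurable κ) (hc : Monotone c) (hc0 : c 0 = 0)
    (hn : ∀ x, κ x ≤ n) (hfin : μ {x | 1 ≤ κ x} ≠ ∞)
    (hcf : ∀ x, c (κ x) ≤ |f x|) (hB : ∀ x, 1 ≤ κ x → |f x| ≤ B) {p s : ℝ≥0∞}
    (hp : 1 < p) (hps : p < s) (hs : s ≠ ∞) :
    lorentzNorm (fun x => c (κ x)) p s μ ≤ lorentzConst p s * dualNorm f p s μ := by
  have hp' : p ≠ ∞ := (hps.trans_le le_top).ne
  have hs1 : 1 < s := hp.trans hps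
  have hcn : ∀ k, 0 ≤ c k := fun k => hc0 ▸ hc (Nat.zero_le k)
  rw [lorentzConst_of_ne_top hp hp' hs1 hs, lorentzNorm_step hc hc0 hn hfin
    (Filter.Eventually.of_forall fun x => by
      rw [Real.enorm_eq_ofReal_abs, abs_of_nonneg (hcn _)])
    hp' (zero_lt_one.trans hp).ne' hs (zero_lt_one.trans hs1).ne']
  have hP := holderConjugate_toReal hp hp'
  have hS := holderConjugate_toReal hs1 hs
  have hPS : p.toReal < s.toReal := (ENNReal.toReal_lt_toReal hp' hs).2 hps
  have hnorm := fun (m : ℕ → ℝ) (hm : Monotone m) (hm0 : m 0 = 0) (g : R → ℝ)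
    (hg : ∀ᵐ x ∂μ, ‖g x‖ₑ = ENNReal.ofReal (m (κ x))) =>
    lorentzNorm_step hm hm0 hn hfin hg (conjExponent_ne_top hp) (conjExponent_ne_zero p)
      (conjExponent_ne_top hs1) (conjExponent_ne_zero s)
  set P := p.toReal
  set S := s.toReal
  set P' := p.conjExponent.toReal
  set S' := s.conjExponent.toReal
  have hP0 := hP.pos
  have hS0 := hS.pos
  have hP0' := hP.symm.pos
  have hS0' := hS.symm.pos
  set w : ℕ → ℝ := fun k => μ.real {x | k + 1 ≤ κ x} with hw
  have hfin' : ∀ k, μ {x | k + 1 ≤ κ x} ≠ ∞ := fun k =>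
    measure_ne_top_of_subset (fun x (hx : k + 1 ≤ κ x) => (by omega : 1 ≤ κ x)) hfin
  have hwa : Antitone w := fun i j hij =>
    measureReal_mono (fun x (hx : j + 1 ≤ κ x) => (by omega : i + 1 ≤ κ x)) (hfin' i)
  have hw0 : ∀ k, 0 ≤ w k := fun k => measureReal_nonneg
  have hwn : w n = 0 := by
    have : {x | n + 1 ≤ κ x} = ∅ := by
      ext x; simpa using Nat.lt_succ_of_le (hn x)
    simp only [hw, this, measureReal_empty]
  -- With `u = w^(S'/P')`, this exponent turns `u^(1+a)` into `w` and `u^(a*S+1)` into `w^(S/P)`; `a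
  -- ≥ 0` is where `p < s` enters.
  set a := P' / S' - 1 with ha
  have e1 : P' = P / (P - 1) := hP.conjugate_eq
  have e2 : S' = S / (S - 1) := hS.conjugate_eq
  have hP1 := hP.sub_one_pos
  have hS1 := hS.sub_one_pos
  have ha0 : 0 ≤ a := by
    rw [ha, sub_nonneg, le_div_iff₀ hS0', one_mul, e1, e2, div_le_div_iff₀ hS1 hP1]
    linarith
  set u : ℕ → ℝ := fun k => w k ^ (S' / P') with hu
  have hu0 : ∀ k, 0 ≤ u k := fun k => Real.rpow_nonneg (hw0 k) _
  have hua : Antitone u := fun i j hij =>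
    Real.rpow_le_rpow (hw0 j) (hwa hij) (by positivity)
  have hun : u n = 0 := by
    simp only [hu, hwn]; exact Real.zero_rpow (by positivity)
  have hu1 : ∀ k, u k ^ (1 + a) = w k := fun k => by
    rw [hu, ← Real.rpow_mul (hw0 k), ha]
    have : S' / P' * (1 + (P' / S' - 1)) = 1 := by field_simp; ring
    rw [this, Real.rpow_one]
  have hu2 : ∀ k, u k ^ (a * S + 1) = w k ^ (S / P) := fun k => by
    rw [hu, ← Real.rpow_mul (hw0 k), ha]
    have : S' / P' * ((P' / S' - 1) * S + 1) = S / P := by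
      rw [e1, e2]; field_simp; ring
    rw [this]
  have key := rpow_mul_rpow_le_sum hS ha0 hc hc0 hu0 hua hun
  have key0 := sum_young_le hS.lt ha0 hc hc0 hu0 hun
  simp_rw [hu1, hu2] at key key0
  set M := runMax a c u
  have hM0 : ∀ k, 0 ≤ M k := runMax_nonneg a c u
  have hMm : Monotone M := runMax_mono a c u
  set T := ∑ k ∈ Finset.range n, M (k + 1) ^ S * (u k - u (k + 1)) with hT
  set Y := ∑ k ∈ Finset.range n, c (k + 1) ^ S * (w k ^ (S / P) - w (k + 1) ^ (S / P))
  set X := ∑ k ∈ Finset.range n, c (k + 1) * M (k + 1) ^ (S - 1) * (w k - w (k + 1)) with hX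
  have hTt : ∀ k ∈ Finset.range n, 0 ≤ M (k + 1) ^ S * (u k - u (k + 1)) := fun k _ =>
    mul_nonneg (Real.rpow_nonneg (hM0 _) _) (sub_nonneg.2 (hua k.le_succ))
  have hT0 : 0 ≤ T := Finset.sum_nonneg hTt
  have hY0 : 0 ≤ Y := Finset.sum_nonneg fun k _ => mul_nonneg
    (Real.rpow_nonneg (hcn _) _) (sub_nonneg.2 (Real.rpow_le_rpow (hw0 _) (hwa k.le_succ)
      (by positivity)))
  -- If `T = 0` the test function cannot be normalised and the product form is void, but the
  -- additive form gives `Y = 0`.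
  rcases hT0.eq_or_lt with hTz | hTpos
  · have hXz : X = 0 := by
      refine Finset.sum_eq_zero fun k hk => ?_
      rcases mul_eq_zero.1 ((Finset.sum_eq_zero_iff_of_nonneg hTt).1 hTz.symm k hk) with h | h
      · rw [(Real.rpow_eq_zero (hM0 _) hS0.ne').1 h, Real.zero_rpow hS1.ne']; ring
      · rw [← hu1 k, ← hu1 (k + 1), sub_eq_zero.1 h]; ring
    have hYz : Y = 0 := by
      rw [← hTz, hXz] at key0
      linarith
    rw [hYz, mul_zero, Real.zero_rpow (by positivity), ENNReal.ofReal_zero]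
    exact zero_le
  -- The Lorentz functional of `M^(S-1) ∘ κ`, because `(S - 1) * S' = S`.
  set G := (P' / S' * T) ^ (1 / S') with hG
  have hGpos : 0 < G := by positivity
  set m : ℕ → ℝ := fun k => M k ^ (S - 1) / G with hm
  have hmm : Monotone m := fun i j hij =>
    div_le_div_of_nonneg_right (Real.rpow_le_rpow (hM0 i) (hMm hij) hS1.le) hGpos.le
  have hm0 : m 0 = 0 := by
    simp only [hm, M, runMax]
    rw [Real.zero_rpow hS1.ne', zero_div]
  have hmS : ∀ k, m k ^ S' = M k ^ S / (P' / S' * T) := fun k => by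
    rw [hm, Real.div_rpow (Real.rpow_nonneg (hM0 k) _) hGpos.le, ← Real.rpow_mul (hM0 k), hG,
      ← Real.rpow_mul (by positivity), one_div_mul_cancel hS0'.ne', Real.rpow_one, e2,
      mul_div_cancel₀ _ hS1.ne']
  have hdual := le_dualNorm_of_level (p := p) (s := s) hfm hκ hn hfin hcn hmm hm0 hcf hB
    (fun g hg => by
      rw [hnorm m hmm hm0 g hg]
      have hs : ∑ k ∈ Finset.range n, m (k + 1) ^ S' *
          (w k ^ (S' / P') - w (k + 1) ^ (S' / P')) = T / (P' / S' * T) := by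
        rw [hT, Finset.sum_div]
        refine Finset.sum_congr rfl fun k _ => ?_
        rw [hmS]
        simp only [hu]
        ring
      rw [hs, ← mul_div_assoc, div_self (by positivity), Real.one_rpow, ENNReal.ofReal_one])
  have hXG : ∑ k ∈ Finset.range n, c (k + 1) * m (k + 1) * (w k - w (k + 1)) = X / G := by
    rw [hX, Finset.sum_div]
    refine Finset.sum_congr rfl fun k _ => ?_
    simp only [hm]
    ring
  refine le_trans ?_ (mul_le_mul_right (hXG ▸ hdual) _)
  rw [← ENNReal.ofReal_mul (by positivity)]
  refine ENNReal.ofReal_le_ofReal ?_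
  rw [Real.mul_rpow (by positivity) hY0, mul_assoc]
  refine mul_le_mul_of_nonneg_left ?_ (by positivity)
  rw [hG, Real.mul_rpow (by positivity) hT0, ← mul_div_assoc,
    mul_div_mul_left _ _ (by positivity), le_div_iff₀ (by positivity)]
  exact key

end

/-! ### Passage to general functions by dyadic truncation. -/

section

variable {R : Type*} [MeasurableSpace R] {μ : Measure R}

/-- The Lorentz functional is continuous along increasing sequences. -/
lemma lorentzNorm_le_of_monotone {f : R → ℝ} {F : ℕ → R → ℝ} {p s K : ℝ≥0∞} (hs : s ≠ ∞)
    (hs0 : s ≠ 0) (hmono : ∀ x, Monotone fun n => ‖F n x‖ₑ)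
    (hlim : ∀ x l, l < ‖f x‖ₑ → ∃ n, l < ‖F n x‖ₑ)
    (hK : ∀ n, lorentzNorm (F n) p s μ ≤ K) : lorentzNorm f p s μ ≤ K := by
  have hS : 0 < s.toReal := ENNReal.toReal_pos hs0 hs
  have hrm : ∀ t, Monotone fun n => rearrangement (F n) μ t := fun t i j hij =>
    rearrangement_mono (Filter.Eventually.of_forall fun x => hmono x hij) t
  have hr : ∀ t, rearrangement f μ t ≤ ⨆ n, rearrangement (F n) μ t := fun t => by
    refine le_of_forall_lt fun l hl => ?_
    rw [lt_rearrangement_iff] at hl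
    have hsub : {x | l < ‖f x‖ₑ} ⊆ ⋃ n, {x | l < ‖F n x‖ₑ} := fun x hx =>
      Set.mem_iUnion.2 (hlim x l hx)
    have hm : Monotone fun n => {x | l < ‖F n x‖ₑ} := fun i j hij x (hx : l < _) =>
      hx.trans_le (hmono x hij)
    have h2 := hl.trans_le (measure_mono hsub)
    rw [hm.measure_iUnion, lt_iSup_iff] at h2
    obtain ⟨n, hn⟩ := h2
    exact (lt_rearrangement_iff.2 hn).trans_le (le_iSup (fun n => rearrangement (F n) μ t) n)
  have hK' : ∀ n, ∫⁻ t in Set.Ioi (0 : ℝ),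
      ENNReal.ofReal (t ^ (s.toReal / p.toReal - 1)) *
        rearrangement (F n) μ (ENNReal.ofReal t) ^ s.toReal ≤ K ^ s.toReal := fun n => by
    have := hK n
    rw [lorentzNorm_of_ne_top _ _ hs, one_div, ENNReal.rpow_inv_le_iff hS] at this
    exact this
  rw [lorentzNorm_of_ne_top _ _ hs, one_div, ENNReal.rpow_inv_le_iff hS]
  have hmeas : ∀ n, Measurable fun t : ℝ =>
      ENNReal.ofReal (t ^ (s.toReal / p.toReal - 1)) *
        rearrangement (F n) μ (ENNReal.ofReal t) ^ s.toReal := fun n => by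
    have : Measurable fun t : ℝ => rearrangement (F n) μ (ENNReal.ofReal t) :=
      (rearrangement_anti (F n)).measurable.comp ENNReal.measurable_ofReal
    fun_prop
  calc _ ≤ ∫⁻ t in Set.Ioi (0 : ℝ), ⨆ n, ENNReal.ofReal (t ^ (s.toReal / p.toReal - 1)) *
        rearrangement (F n) μ (ENNReal.ofReal t) ^ s.toReal := by
        refine lintegral_mono fun t => ?_
        rw [← ENNReal.mul_iSup]
        refine mul_le_mul_right ?_ _
        refine (ENNReal.rpow_le_rpow (hr _) hS.le).trans_eq ?_
        exact (ENNReal.orderIsoRpow _ hS).map_iSup _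
    _ = ⨆ n, ∫⁻ t in Set.Ioi (0 : ℝ), ENNReal.ofReal (t ^ (s.toReal / p.toReal - 1)) *
        rearrangement (F n) μ (ENNReal.ofReal t) ^ s.toReal := by
        refine lintegral_iSup hmeas fun i j hij t => ?_
        have := hrm (ENNReal.ofReal t) hij
        simp only at this ⊢
        gcongr
    _ ≤ _ := iSup_le hK'

/-- Otherwise `f* ≥ l` everywhere, and the weight makes the functional infinite. -/
lemma measure_lt_top_of_lorentzNorm {f : R → ℝ} {p s : ℝ≥0∞} (hp : p ≠ ∞) (hp0 : p ≠ 0)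
    (hs0 : s ≠ 0) (hf : lorentzNorm f p s μ < ∞) {l : ℝ≥0∞} (hl : 0 < l) (hl' : l ≠ ∞) :
    μ {x | l < ‖f x‖ₑ} < ∞ := by
  by_contra h
  have hr : ∀ t : ℝ, l ≤ rearrangement f μ (ENNReal.ofReal t) := fun t =>
    (lt_rearrangement_iff.2 (ENNReal.ofReal_lt_top.trans_le (not_lt.1 h))).le
  have hP := ENNReal.toReal_pos hp0 hp
  refine hf.ne (top_le_iff.1 (ENNReal.le_of_forall_nnreal_lt fun r _ => ?_))
  have hlr := ENNReal.toReal_pos hl.ne' hl'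
  by_cases hs : s = ∞
  · subst hs
    rw [lorentzNorm_top]
    -- Chosen so that `t^(1/p) * l = r + 1`.
    set t : ℝ := ((r + 1) / l.toReal) ^ p.toReal with ht
    have htp : 0 < t := by positivity
    refine le_iSup₂_of_le t htp ((?_ : _ ≤ _).trans (mul_le_mul_right (hr t) _))
    rw [ht, ← Real.rpow_mul (by positivity), mul_one_div_cancel hP.ne', Real.rpow_one,
      ← ENNReal.ofReal_toReal hl', ENNReal.toReal_ofReal hlr.le, ← ENNReal.ofReal_mul
      (by positivity), div_mul_cancel₀ _ hlr.ne', ← ENNReal.ofReal_coe_nnreal]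
    exact ENNReal.ofReal_le_ofReal (by linarith)
  · have hS := ENNReal.toReal_pos hs0 hs
    rw [lorentzNorm_of_ne_top _ _ hs, one_div, ENNReal.le_rpow_inv_iff hS]
    have hb : 0 < s.toReal / p.toReal := div_pos hS hP
    set b := s.toReal / p.toReal
    -- The solution of `N^b / b * l^s = r^s`: the integral up to `N` already reaches `r^s`.
    set N : ℝ := (b * (r / l.toReal) ^ s.toReal) ^ (1 / b) with hN
    have hN0 : 0 ≤ N := by positivity
    calc (r : ℝ≥0∞) ^ s.toReal = ENNReal.ofReal (N ^ b / b) * l ^ s.toReal := by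
          rw [hN, ← Real.rpow_mul (by positivity), one_div_mul_cancel hb.ne', Real.rpow_one,
            mul_div_cancel_left₀ _ hb.ne', ← ENNReal.ofReal_rpow_of_nonneg (by positivity) hS.le,
            ← ENNReal.mul_rpow_of_nonneg _ _ hS.le]
          congr 1
          calc (r : ℝ≥0∞) = ENNReal.ofReal (r / l.toReal) * ENNReal.ofReal l.toReal := by
                rw [← ENNReal.ofReal_mul (by positivity), div_mul_cancel₀ _ hlr.ne',
                  ENNReal.ofReal_coe_nnreal]
            _ = _ := by rw [ENNReal.ofReal_toReal hl']
      _ = ∫⁻ t in Set.Ico 0 N ∩ Set.Ioi 0, ENNReal.ofReal (t ^ (b - 1)) * l ^ s.toReal := by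
          rw [lintegral_mul_const _ (by fun_prop), setLIntegral_Ico_rpow hb hN0,
            max_eq_left hN0, max_self, Real.zero_rpow hb.ne', sub_zero]
      _ ≤ ∫⁻ t in Set.Ioi 0, ENNReal.ofReal (t ^ (b - 1)) * l ^ s.toReal :=
          lintegral_mono_set Set.inter_subset_right
      _ ≤ _ := by
          gcongr with t
          exact hr t

lemma dualNorm_congr {f g : R → ℝ} (p s : ℝ≥0∞) (h : f =ᵐ[μ] g) :
    dualNorm f p s μ = dualNorm g p s μ := by
  simp only [dualNorm]
  refine iSup_congr fun k => iSup_congr fun _ => iSup_congr fun _ => ?_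
  have : (fun x => f x * k x) =ᵐ[μ] fun x => g x * k x := h.mono fun x hx => by
    simp only [hx]
  rw [integral_congr_ae this]

/-- Level index of `y` at scale `2 ^ n`, set to `0` when `2 ^ n < y`. -/
noncomputable def dyadicLevel (n : ℕ) (y : ℝ) : ℕ :=
  if y ≤ 2 ^ n then ⌊2 ^ n * y⌋₊ else 0

lemma dyadicLevel_le (n : ℕ) (y : ℝ) : dyadicLevel n y ≤ 2 ^ n * 2 ^ n := by
  unfold dyadicLevel
  split_ifs with h
  · refine Nat.floor_le_of_le ?_
    push_cast
    gcongr
  · exact Nat.zero_le _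

lemma dyadicLevel_div_le (n : ℕ) {y : ℝ} (hy : 0 ≤ y) :
    (dyadicLevel n y : ℝ) / 2 ^ n ≤ y := by
  unfold dyadicLevel
  split_ifs with h
  · rw [div_le_iff₀' (by positivity)]
    exact Nat.floor_le (by positivity)
  · simpa using hy

lemma dyadicLevel_bound (n : ℕ) {y : ℝ} (h : 1 ≤ dyadicLevel n y) :
    y ≤ 2 ^ n ∧ 1 / 2 ^ n ≤ y := by
  unfold dyadicLevel at h
  split_ifs at h with h1
  · refine ⟨h1, ?_⟩
    rw [Nat.one_le_floor_iff] at h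
    rwa [div_le_iff₀' (by positivity)]
  · omega

lemma dyadicLevel_monotone {y : ℝ} (hy : 0 ≤ y) :
    Monotone fun n => (dyadicLevel n y : ℝ) / 2 ^ n := by
  refine monotone_nat_of_le_succ fun n => ?_
  unfold dyadicLevel
  split_ifs with h1 h2 h2
  · rw [pow_succ, div_le_div_iff₀ (by positivity) (by positivity)]
    have : 2 * ⌊(2 : ℝ) ^ n * y⌋₊ ≤ ⌊(2 : ℝ) ^ n * 2 * y⌋₊ := by
      refine Nat.le_floor ?_
      push_cast
      have := Nat.floor_le (show 0 ≤ (2 : ℝ) ^ n * y by positivity)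
      linarith
    have h3 : (2 : ℝ) * ⌊(2 : ℝ) ^ n * y⌋₊ ≤ ⌊(2 : ℝ) ^ n * 2 * y⌋₊ := by exact_mod_cast this
    have h4 : (0 : ℝ) < 2 ^ n := by positivity
    nlinarith
  · exact absurd (h1.trans (pow_le_pow_right₀ one_le_two n.le_succ)) h2
  · simp only [Nat.cast_zero, zero_div]; positivity
  · simp

lemma exists_lt_dyadicLevel {l y : ℝ} (h : l < y) :
    ∃ n, l < (dyadicLevel n y : ℝ) / 2 ^ n := by
  obtain ⟨m, hm⟩ := pow_unbounded_of_one_lt (max y (1 / (y - l))) (one_lt_two (α := ℝ))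
  refine ⟨m, ?_⟩
  have h2 : (0 : ℝ) < 2 ^ m := by positivity
  rw [dyadicLevel, if_pos ((le_max_left _ _).trans hm.le), lt_div_iff₀' h2]
  have h1 := (le_max_right _ _).trans_lt hm
  rw [div_lt_iff₀ (sub_pos.2 h)] at h1
  have h3 := Nat.lt_floor_add_one ((2 : ℝ) ^ m * y)
  linarith

lemma measurable_dyadicLevel (n : ℕ) : Measurable (dyadicLevel n) :=
  Measurable.ite measurableSet_Iic (by fun_prop) measurable_const

lemma lorentzNorm_le_dualNorm_of_ne_top {f : R → ℝ} {p s : ℝ≥0∞} (hp : 1 < p) (hps : p < s)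
    (hs : s ≠ ∞) (hf : MemLorentz f p s μ) :
    lorentzNorm f p s μ ≤ lorentzConst p s * dualNorm f p s μ := by
  obtain ⟨hfm, hfin⟩ := hf
  rw [lorentzNorm_congr p s hfm.ae_eq_mk] at hfin ⊢
  rw [dualNorm_congr p s hfm.ae_eq_mk]
  have hm : Measurable (hfm.mk f) := hfm.stronglyMeasurable_mk.measurable
  set g := hfm.mk f
  have hp' : p ≠ ∞ := (hps.trans_le le_top).ne
  have hs1 := hp.trans hps
  refine lorentzNorm_le_of_monotone (F := fun n x => (dyadicLevel n |g x| : ℝ) / 2 ^ n) hs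
    (zero_lt_one.trans hs1).ne' (fun x i j hij => ?_) (fun x l hl => ?_) fun n => ?_
  · have := dyadicLevel_monotone (abs_nonneg (g x)) hij
    simp only at this ⊢
    rw [Real.enorm_of_nonneg (by positivity), Real.enorm_of_nonneg (by positivity)]
    exact ENNReal.ofReal_le_ofReal this
  · have hlt : l ≠ ∞ := (hl.trans_le le_top).ne
    rw [Real.enorm_eq_ofReal_abs, ← ENNReal.ofReal_toReal hlt, ENNReal.ofReal_lt_ofReal_iff'] at hl
    obtain ⟨n, hn⟩ := exists_lt_dyadicLevel hl.1
    refine ⟨n, ?_⟩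
    rw [Real.enorm_of_nonneg (by positivity), ← ENNReal.ofReal_toReal hlt,
      ENNReal.ofReal_lt_ofReal_iff']
    exact ⟨hn, ENNReal.toReal_nonneg.trans_lt hn⟩
  · refine lorentzNorm_level_le_dualNorm (κ := fun x => dyadicLevel n |g x|)
      (c := fun k => (k : ℝ) / 2 ^ n) hm ((measurable_dyadicLevel n).comp hm.abs)
      (fun i j hij => by simp only; gcongr) (by simp) (fun x => dyadicLevel_le n _) ?_
      (fun x => dyadicLevel_div_le n (abs_nonneg _)) (fun x hx => (dyadicLevel_bound n hx).1)
      hp hps hs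
    -- A nonzero level only gives `|g| ≥ 2^(-n)`; halving the threshold makes the inequality strict.
    refine measure_ne_top_of_subset (fun x hx => ?_) (measure_lt_top_of_lorentzNorm hp'
      (zero_lt_one.trans hp).ne' (zero_lt_one.trans hs1).ne' hfin
      (l := ENNReal.ofReal (1 / 2 ^ (n + 1))) (by simp) ENNReal.ofReal_ne_top).ne
    refine (?_ : _ < ‖g x‖ₑ)
    have h1 := (dyadicLevel_bound n hx).2
    have h2 : (1 : ℝ) / 2 ^ (n + 1) < 1 / 2 ^ n :=
      one_div_lt_one_div_of_lt (by positivity) (pow_lt_pow_right₀ one_lt_two n.lt_succ_self)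
    rw [Real.enorm_eq_ofReal_abs, ENNReal.ofReal_lt_ofReal_iff']
    exact ⟨h2.trans_le h1, (by positivity : (0 : ℝ) < 1 / 2 ^ (n + 1)).trans (h2.trans_le h1)⟩

end

/-! ### An upper bound for the dual norm of an indicator. -/

section

lemma volume_ofReal_lt (y : ℝ≥0∞) :
    volume ({l : ℝ | ENNReal.ofReal l < y} ∩ Set.Ioi 0) = y := by
  rcases eq_or_ne y ∞ with rfl | hy
  · simp
  · have : {l : ℝ | ENNReal.ofReal l < y} ∩ Set.Ioi 0 = Set.Ioo 0 y.toReal := by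
      ext l
      change ENNReal.ofReal l < y ∧ 0 < l ↔ 0 < l ∧ l < y.toReal
      refine ⟨fun ⟨h1, h2⟩ => ⟨h2, (ENNReal.ofReal_lt_iff_lt_toReal h2.le hy).1 h1⟩,
        fun ⟨h2, h1⟩ => ⟨(ENNReal.ofReal_lt_iff_lt_toReal h2.le hy).2 h1, h2⟩⟩
    rw [this, Real.volume_Ioo, sub_zero, ENNReal.ofReal_toReal hy]

/-- The layer cake formula for functions with values in `[0, ∞]`. -/
lemma lintegral_eq_lintegral_meas_ofReal_lt {α : Type*} [MeasurableSpace α] (ν : Measure α)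
    [SFinite ν] {F : α → ℝ≥0∞} (hF : Measurable F) :
    ∫⁻ x, F x ∂ν = ∫⁻ l in Set.Ioi (0 : ℝ), ν {x | ENNReal.ofReal l < F x} := by
  have hm : MeasurableSet {z : α × ℝ | ENNReal.ofReal z.2 < F z.1} :=
    measurableSet_lt (by fun_prop) (by fun_prop)
  set D : α → ℝ → ℝ≥0∞ := fun x l =>
    {z : α × ℝ | ENNReal.ofReal z.2 < F z.1}.indicator (fun _ => 1) (x, l)
  have h1 : ∀ x, F x = ∫⁻ l in Set.Ioi (0 : ℝ), D x l := fun x => by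
    have hx : MeasurableSet {l : ℝ | ENNReal.ofReal l < F x} :=
      measurableSet_lt (by fun_prop) (by fun_prop)
    calc F x = ∫⁻ l in Set.Ioi (0 : ℝ), {l : ℝ | ENNReal.ofReal l < F x}.indicator 1 l := by
          rw [lintegral_indicator_one hx, Measure.restrict_apply hx, volume_ofReal_lt]
      _ = _ := rfl
  rw [lintegral_congr h1, lintegral_lintegral_swap]
  · refine lintegral_congr fun l => ?_
    have hx : MeasurableSet {x | ENNReal.ofReal l < F x} :=
      measurableSet_lt (by fun_prop) (by fun_prop)
    rw [← lintegral_indicator_one hx]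
    rfl
  · exact (measurable_const.indicator hm).aemeasurable

variable {R : Type*} [MeasurableSpace R] {μ : Measure R}

/-- A Hölder inequality for the integral over a set of finite measure, with the sharp constant. -/
lemma setLIntegral_enorm_le {g : R → ℝ} (hg : Measurable g) {E : Set R}
    (hE : μ E ≠ ∞) (hE0 : μ E ≠ 0) {q r : ℝ≥0∞} (hq : q ≠ ∞) (hr1 : 1 ≤ r) (hrq : r ≤ q) :
    ∫⁻ x in E, ‖g x‖ₑ ∂μ ≤ ENNReal.ofReal ((r.toReal / q.toReal) ^ (1 / r.toReal) *
      μ.real E ^ (1 - 1 / q.toReal)) * lorentzNorm g q r μ := by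
  have hr : r ≠ ∞ := (hrq.trans_lt hq.lt_top).ne
  have hQ1 : 1 ≤ r.toReal := by
    rw [← ENNReal.toReal_one]; exact ENNReal.toReal_mono hr hr1
  have hQP : r.toReal ≤ q.toReal := ENNReal.toReal_mono hq hrq
  rw [lorentzNorm_of_ne_top g q hr]
  set Q := r.toReal
  set P := q.toReal
  have hQ : 0 < Q := by linarith
  have hP : 0 < P := by linarith
  set m := μ.real E with hm
  have hmpos : 0 < m := ENNReal.toReal_pos hE0 hE
  have hmE : ENNReal.ofReal m = μ E := ENNReal.ofReal_toReal hE
  set b := Q / P with hb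
  have hbpos : 0 < b := div_pos hQ hP
  have hb1 : b ≤ 1 := (div_le_one hP).2 hQP
  -- Normalises `t^(b-1)` on `(0, m)` to a probability density, with distribution function `(y /
  -- m)^b`.
  set K : ℝ := b * m ^ (-b) with hK
  have hK0 : 0 < K := by positivity
  set ν : Measure ℝ := (volume.restrict (Set.Ico 0 m ∩ Set.Ioi 0)).withDensity
    (fun t => ENNReal.ofReal K * ENNReal.ofReal (t ^ (b - 1))) with hν
  have hdens : Measurable fun t : ℝ => ENNReal.ofReal K * ENNReal.ofReal (t ^ (b - 1)) := by
    fun_prop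
  have hν_Ico : ∀ y, 0 ≤ y → y ≤ m → ν (Set.Ico 0 y) = ENNReal.ofReal ((y / m) ^ b) := by
    intro y hy0 hym
    have : Set.Ico 0 y ∩ (Set.Ico 0 m ∩ Set.Ioi 0) = Set.Ico 0 y ∩ Set.Ioi 0 := by
      rw [← Set.inter_assoc, Set.inter_eq_left.2 (Set.Ico_subset_Ico_right hym)]
    rw [hν, withDensity_apply _ measurableSet_Ico, Measure.restrict_restrict measurableSet_Ico,
      this, lintegral_const_mul _ (by fun_prop), setLIntegral_Ico_rpow hbpos hy0,
      max_eq_left hy0, max_self, Real.zero_rpow hbpos.ne', sub_zero,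
      ← ENNReal.ofReal_mul hK0.le, Real.div_rpow hy0 hmpos.le, hK, Real.rpow_neg hmpos.le]
    congr 1
    field_simp
  have hν_compl : ν (Set.Ico 0 m)ᶜ = 0 := by
    rw [hν, withDensity_apply _ measurableSet_Ico.compl,
      Measure.restrict_restrict measurableSet_Ico.compl, ← Set.inter_assoc,
      Set.compl_inter_self, Set.empty_inter]
    simp
  have hprob : IsProbabilityMeasure ν := ⟨by
    rw [← measure_add_measure_compl (measurableSet_Ico (a := (0 : ℝ)) (b := m)), hν_compl,
      hν_Ico m hmpos.le le_rfl, div_self hmpos.ne', Real.one_rpow, ENNReal.ofReal_one, add_zero]⟩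
  set G : ℝ → ℝ≥0∞ := fun t => rearrangement g μ (ENNReal.ofReal t) with hG
  have hGm : Measurable G :=
    (rearrangement_anti g).measurable.comp ENNReal.measurable_ofReal
  have hfinE : IsFiniteMeasure (μ.restrict E) := ⟨by simpa using hE.lt_top⟩
  -- Layer by layer, `{|g| > l} ∩ E` has measure `y ≤ m`, and `y / m ≤ (y / m)^b` since `b ≤ 1`;
  -- meanwhile `g* > l` on `[0, y)`.
  have hlayer : ∫⁻ x in E, ‖g x‖ₑ ∂μ ≤ ENNReal.ofReal m * ∫⁻ t, G t ∂ν := by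
    rw [lintegral_eq_lintegral_meas_ofReal_lt _ hg.enorm,
      lintegral_eq_lintegral_meas_ofReal_lt _ hGm, ← lintegral_const_mul' _ _ ENNReal.ofReal_ne_top]
    refine lintegral_mono fun l => ?_
    have hml : MeasurableSet {x | ENNReal.ofReal l < ‖g x‖ₑ} :=
      measurableSet_lt measurable_const hg.enorm
    rw [Measure.restrict_apply hml]
    set A := {x | ENNReal.ofReal l < ‖g x‖ₑ}
    have hDE : μ (A ∩ E) ≤ μ E := measure_mono Set.inter_subset_right
    have hDfin : μ (A ∩ E) ≠ ∞ := (hDE.trans_lt hE.lt_top).ne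
    set y := μ.real (A ∩ E)
    have hy : ENNReal.ofReal y = μ (A ∩ E) := ENNReal.ofReal_toReal hDfin
    have hy0 : 0 ≤ y := measureReal_nonneg
    have hym : y ≤ m := ENNReal.toReal_mono hE hDE
    have hsub : Set.Ico 0 y ⊆ {t | ENNReal.ofReal l < G t} := fun t ht => by
      refine lt_rearrangement_iff.2 ?_
      refine lt_of_lt_of_le ?_ (measure_mono (Set.inter_subset_left : A ∩ E ⊆ A))
      rw [← hy]
      exact (ENNReal.ofReal_lt_ofReal_iff (ht.1.trans_lt ht.2)).2 ht.2
    calc μ (A ∩ E) = ENNReal.ofReal m * ENNReal.ofReal (y / m) := by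
          rw [← ENNReal.ofReal_mul hmpos.le, mul_div_cancel₀ _ hmpos.ne', hy]
      _ ≤ ENNReal.ofReal m * ENNReal.ofReal ((y / m) ^ b) := by
          gcongr
          exact Real.self_le_rpow_of_le_one (by positivity) ((div_le_one hmpos).2 hym) hb1
      _ = ENNReal.ofReal m * ν (Set.Ico 0 y) := by rw [hν_Ico y hy0 hym]
      _ ≤ _ := by gcongr
  -- Jensen for the probability measure `ν`; it is an equality when `g*` is constant on `(0, m)`.
  have hjensen : ∫⁻ t, G t ∂ν ≤ (∫⁻ t, G t ^ Q ∂ν) ^ (1 / Q) := by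
    have := eLpNorm'_le_eLpNorm'_of_exponent_le one_pos hQ1 ν
      hGm.aestronglyMeasurable
    simpa [eLpNorm'] using this
  have hden : ∫⁻ t, G t ^ Q ∂ν ≤ ENNReal.ofReal K *
      ∫⁻ t in Set.Ioi (0 : ℝ), ENNReal.ofReal (t ^ (b - 1)) * G t ^ Q := by
    rw [hν, lintegral_withDensity_eq_lintegral_mul _ hdens (hGm.pow_const Q),
      ← lintegral_const_mul' _ _ ENNReal.ofReal_ne_top]
    refine (lintegral_mono_set Set.inter_subset_right).trans_eq ?_
    refine lintegral_congr fun t => ?_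
    rw [Pi.mul_apply, mul_assoc]
  calc _ ≤ _ := hlayer
    _ ≤ ENNReal.ofReal m * (ENNReal.ofReal K *
      ∫⁻ t in Set.Ioi (0 : ℝ), ENNReal.ofReal (t ^ (b - 1)) * G t ^ Q) ^ (1 / Q) := by
        gcongr
        exact hjensen.trans (ENNReal.rpow_le_rpow hden (by positivity))
    _ = _ := by
        rw [ENNReal.mul_rpow_of_nonneg _ _ (by positivity), ← mul_assoc,
          ENNReal.ofReal_rpow_of_nonneg hK0.le (by positivity), ← ENNReal.ofReal_mul hmpos.le]
        congr 2
        rw [hK, Real.mul_rpow hbpos.le (by positivity), ← Real.rpow_mul hmpos.le,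
          mul_left_comm]
        congr 1
        have : -b * (1 / Q) = -(1 / P) := by rw [hb]; field_simp
        rw [this, sub_eq_add_neg, Real.rpow_add hmpos, Real.rpow_one]

lemma dualNorm_indicator_le {E : Set R} (hEm : MeasurableSet E) (hE : μ E ≠ ∞) (hE0 : μ E ≠ 0)
    {p s : ℝ≥0∞} (hp : 1 < p) (hps : p < s) :
    dualNorm (E.indicator 1) p s μ ≤ ENNReal.ofReal
      ((s.conjExponent.toReal / p.conjExponent.toReal) ^ (1 / s.conjExponent.toReal) *
        μ.real E ^ (1 / p.toReal)) := by
  have hp' : p ≠ ∞ := (hps.trans_le le_top).ne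
  refine iSup₂_le fun g hg => iSup_le fun h1 => ?_
  have hgm := hg.1
  rw [lorentzNorm_congr _ _ hgm.ae_eq_mk] at h1
  have hm : Measurable (hgm.mk g) := hgm.stronglyMeasurable_mk.measurable
  have hle := setLIntegral_enorm_le (q := p.conjExponent) (r := s.conjExponent) hm hE hE0
    (conjExponent_ne_top hp) le_self_add
    (by unfold ENNReal.conjExponent; gcongr)
  have hexp : 1 - 1 / p.conjExponent.toReal = 1 / p.toReal := by
    have := (holderConjugate_toReal hp hp').inv_add_inv_eq_one
    rw [one_div, one_div]; linarith
  rw [h1, mul_one, hexp] at hle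
  refine le_trans ?_ hle
  have hind : ∀ x, E.indicator 1 x * g x = E.indicator g x := fun x => by
    by_cases hx : x ∈ E <;> simp [hx]
  simp_rw [hind]
  rw [integral_indicator hEm, integral_congr_ae (ae_restrict_of_ae hgm.ae_eq_mk)]
  refine (?_ : _ ≤ ‖∫ x in E, hgm.mk g x ∂μ‖ₑ).trans (enorm_integral_le_lintegral_enorm _)
  rw [Real.enorm_eq_ofReal_abs]
  exact ENNReal.ofReal_le_ofReal (le_abs_self _)

end

/-! ### Indicators, the case `s = ∞`, and optimality. -/

section

open Classical in
/-- The indicator function of a set with values in `ℕ`. -/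
noncomputable def natIndicator {R : Type*} (E : Set R) (x : R) : ℕ := if x ∈ E then 1 else 0

lemma natIndicator_le {R : Type*} (E : Set R) (x : R) : natIndicator E x ≤ 1 := by
  unfold natIndicator; split_ifs <;> simp

lemma setOf_one_le_natIndicator {R : Type*} (E : Set R) : {x | 1 ≤ natIndicator E x} = E := by
  ext x
  change 1 ≤ natIndicator E x ↔ x ∈ E
  unfold natIndicator; split_ifs with h <;> simp [h]

lemma setOf_two_le_natIndicator {R : Type*} (E : Set R) : {x | 1 + 1 ≤ natIndicator E x} = ∅ := by
  ext x
  change 2 ≤ natIndicator E x ↔ False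
  have := natIndicator_le E x
  simp only [iff_false]; omega

variable {R : Type*} [MeasurableSpace R] {μ : Measure R}

lemma measurable_natIndicator {E : Set R} (hE : MeasurableSet E) :
    Measurable (natIndicator E) := by
  classical
  exact Measurable.ite hE measurable_const measurable_const

lemma monotone_natCast_mul {l : ℝ} (hl : 0 ≤ l) : Monotone fun k : ℕ => (k : ℝ) * l :=
  fun i j hij => by simp only; gcongr

lemma lorentzNorm_of_enorm_eq {f : R → ℝ} {E : Set R} {l : ℝ} (hl : 0 ≤ l) (hE : μ E ≠ ∞)
    (hf : ∀ᵐ x ∂μ, ‖f x‖ₑ = ENNReal.ofReal (natIndicator E x * l)) {p s : ℝ≥0∞}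
    (hp : p ≠ ∞) (hp0 : p ≠ 0) (hs : s ≠ ∞) (hs0 : s ≠ 0) :
    lorentzNorm f p s μ = ENNReal.ofReal
      ((p.toReal / s.toReal) ^ (1 / s.toReal) * (l * μ.real E ^ (1 / p.toReal))) := by
  have hP := ENNReal.toReal_pos hp0 hp
  have hS := ENNReal.toReal_pos hs0 hs
  rw [lorentzNorm_step (κ := natIndicator E) (n := 1) (monotone_natCast_mul hl) (by simp)
    (natIndicator_le E) (by rwa [setOf_one_le_natIndicator]) hf hp hp0 hs hs0]
  simp only [Finset.sum_range_one, zero_add, setOf_one_le_natIndicator,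
    setOf_two_le_natIndicator, measureReal_empty, Nat.cast_one, one_mul]
  rw [Real.zero_rpow (by positivity), sub_zero, Real.mul_rpow (by positivity) (by positivity),
    Real.mul_rpow (by positivity) (by positivity), ← Real.rpow_mul hl,
    ← Real.rpow_mul measureReal_nonneg, mul_one_div_cancel hS.ne', Real.rpow_one]
  congr 4
  field_simp

lemma rearrangement_indicator {E : Set R} (t : ℝ≥0∞) :
    rearrangement (E.indicator 1) μ t = if t < μ E then 1 else 0 := by
  split_ifs with h
  · refine le_antisymm (sInf_le ?_) (le_of_forall_lt fun l hl => lt_rearrangement_iff.2 ?_)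
    · have : {x | 1 < ‖E.indicator (1 : R → ℝ) x‖ₑ} = ∅ := by
        ext x
        by_cases hx : x ∈ E <;> simp [hx]
      change μ {x | 1 < ‖E.indicator (1 : R → ℝ) x‖ₑ} ≤ t
      simp [this]
    · refine h.trans_le (measure_mono fun x hx => ?_)
      change l < ‖E.indicator (1 : R → ℝ) x‖ₑ
      simpa [hx] using hl
  · refine rearrangement_eq_zero (le_trans (measure_mono fun x hx => ?_) (not_lt.1 h))
    by_contra hxE
    simp [hxE] at hx

lemma lorentzNorm_indicator {E : Set R} (hE : μ E ≠ ∞) {p s : ℝ≥0∞} (hp : p ≠ ∞) (hp0 : p ≠ 0)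
    (hs0 : s ≠ 0) :
    lorentzNorm (E.indicator 1) p s μ =
      (p / s) ^ (1 / s).toReal * ENNReal.ofReal (μ.real E ^ (1 / p.toReal)) := by
  have hP := ENNReal.toReal_pos hp0 hp
  by_cases hs : s = ∞
  · subst hs
    rw [lorentzNorm_top]
    simp only [one_div, ENNReal.inv_top, ENNReal.toReal_zero, ENNReal.rpow_zero, one_mul,
      rearrangement_indicator]
    have hm : ∀ t : ℝ, 0 < t → (ENNReal.ofReal t < μ E ↔ t < μ.real E) := fun t ht =>
      ENNReal.ofReal_lt_iff_lt_toReal ht.le hE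
    refine le_antisymm (iSup₂_le fun t ht => ?_) (le_of_forall_lt fun y hy => ?_)
    · split_ifs with h
      · rw [mul_one]
        rw [hm t ht] at h
        exact ENNReal.ofReal_le_ofReal (Real.rpow_le_rpow ht.le h.le (by positivity))
      · simp
    · have hy' : y ≠ ∞ := (hy.trans_le le_top).ne
      rw [← ENNReal.ofReal_toReal hy', ENNReal.ofReal_lt_ofReal_iff'] at hy
      obtain ⟨hy, hpos⟩ := hy
      have hz : y.toReal ^ p.toReal < μ.real E := by
        have := Real.rpow_lt_rpow ENNReal.toReal_nonneg hy hP
        rwa [← Real.rpow_mul measureReal_nonneg, inv_mul_cancel₀ hP.ne', Real.rpow_one] at this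
      obtain ⟨t, ht1, ht2⟩ := exists_between hz
      have ht0 : 0 < t := lt_of_le_of_lt (Real.rpow_nonneg ENNReal.toReal_nonneg _) ht1
      refine lt_of_lt_of_le ?_ (le_iSup₂ t ht0)
      rw [if_pos ((hm t ht0).2 ht2), mul_one, ← ENNReal.ofReal_toReal hy',
        ENNReal.ofReal_lt_ofReal_iff (by positivity)]
      have := Real.rpow_lt_rpow (by positivity) ht1 (inv_pos.2 hP)
      rwa [← Real.rpow_mul ENNReal.toReal_nonneg, mul_inv_cancel₀ hP.ne', Real.rpow_one] at this
  · have hS := ENNReal.toReal_pos hs0 hs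
    have hf : ∀ x, ‖E.indicator (1 : R → ℝ) x‖ₑ = ENNReal.ofReal (natIndicator E x * 1) :=
      fun x => by by_cases hx : x ∈ E <;> simp [hx, natIndicator]
    rw [lorentzNorm_of_enorm_eq zero_le_one hE (Filter.Eventually.of_forall hf) hp hp0 hs hs0,
      ENNReal.ofReal_mul (by positivity), one_mul, ← ENNReal.ofReal_rpow_of_pos (by positivity),
      ENNReal.ofReal_div_of_pos hS, ENNReal.ofReal_toReal hp, ENNReal.ofReal_toReal hs,
      one_div, one_div s, ENNReal.toReal_inv]

lemma lorentzNorm_le_dualNorm_top {f : R → ℝ} {p : ℝ≥0∞} (hp : 1 < p) (hp' : p ≠ ∞)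
    (hf : MemLorentz f p ∞ μ) :
    lorentzNorm f p ∞ μ ≤ lorentzConst p ∞ * dualNorm f p ∞ μ := by
  obtain ⟨hfm, hfin⟩ := hf
  rw [lorentzNorm_congr p _ hfm.ae_eq_mk] at hfin ⊢
  rw [dualNorm_congr p _ hfm.ae_eq_mk, lorentzConst_top]
  have hm : Measurable (hfm.mk f) := hfm.stronglyMeasurable_mk.measurable
  set g := hfm.mk f
  have hP := holderConjugate_toReal hp hp'
  have hP0 := hP.pos
  have hP0' := hP.symm.pos
  have hq := conjExponent_ne_top hp
  rw [lorentzNorm_top]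
  refine iSup₂_le fun t ht => ENNReal.mul_le_of_forall_lt fun a ha y hy => ?_
  rcases eq_or_ne y 0 with rfl | hy0
  · simp
  have hyt : y ≠ ∞ := (hy.trans_le le_top).ne
  have hA := measure_lt_top_of_lorentzNorm hp' (zero_lt_one.trans hp).ne' ENNReal.top_ne_zero
    hfin (pos_iff_ne_zero.2 hy0) hyt
  rw [lt_rearrangement_iff] at hy
  have hl := ENNReal.toReal_pos hy0 hyt
  set l := y.toReal
  have hly : ENNReal.ofReal l = y := ENNReal.ofReal_toReal hyt
  -- Truncation at height `N` makes `g` bounded on the test set; for large `N` its measure still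
  -- exceeds `t`.
  set A : ℕ → Set R := fun N => {x | y < ‖g x‖ₑ ∧ |g x| ≤ N}
  have hAm : ∀ N, MeasurableSet (A N) := fun N =>
    (measurableSet_lt measurable_const hm.enorm).inter
      (measurableSet_le hm.abs measurable_const)
  have hU : {x | y < ‖g x‖ₑ} ⊆ ⋃ N, A N := fun x hx =>
    Set.mem_iUnion.2 ((exists_nat_ge |g x|).imp fun N hN => ⟨hx, hN⟩)
  have hmono : Monotone A := fun i j hij x hx => ⟨hx.1, hx.2.trans (by exact_mod_cast hij)⟩
  have h2 := hy.trans_le (measure_mono hU)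
  rw [hmono.measure_iUnion, lt_iSup_iff] at h2
  obtain ⟨N, hN⟩ := h2
  set E := A N
  have hE : μ E ≠ ∞ := measure_ne_top_of_subset (fun x hx => hx.1) hA.ne
  have htm : t < μ.real E := (ENNReal.ofReal_lt_iff_lt_toReal ht.le hE).1 hN
  set m := μ.real E with hmdef
  have hmpos : 0 < m := ht.trans htm
  -- The functional of the indicator of `E` in `L^{p',1}`, so that `1 / G` normalises it.
  set G : ℝ := p.conjExponent.toReal * m ^ (1 / p.conjExponent.toReal) with hG
  have hGpos : 0 < G := by positivity
  have key := le_dualNorm_of_level (p := p) (s := ∞) (μ := μ) (κ := natIndicator E) (n := 1)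
    (c := fun k => (k : ℝ) * l) (m := fun k => (k : ℝ) * (1 / G)) (B := N) hm
    (measurable_natIndicator (hAm N)) (natIndicator_le E)
    (by rwa [setOf_one_le_natIndicator]) (fun k => by positivity)
    (monotone_natCast_mul (by positivity)) (by simp)
    (fun x => by
      by_cases hx : x ∈ E
      · have h3 : y < ‖g x‖ₑ := hx.1
        rw [Real.enorm_eq_ofReal_abs, ← hly, ENNReal.ofReal_lt_ofReal_iff'] at h3
        simpa [natIndicator, hx] using h3.1.le
      · simp [natIndicator, hx])
    (fun x hx => by
      have : x ∈ E := by rwa [← setOf_one_le_natIndicator E]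
      exact this.2)
    (fun k hk => by
      rw [conjExponent_top, lorentzNorm_of_enorm_eq (by positivity) hE hk hq
        (conjExponent_ne_zero p) ENNReal.one_ne_top one_ne_zero]
      rw [← hmdef, ENNReal.toReal_one, div_one, div_one, Real.rpow_one, mul_left_comm, ← hG,
        one_div_mul_cancel hGpos.ne', ENNReal.ofReal_one])
  simp only [Finset.sum_range_one, zero_add, setOf_one_le_natIndicator,
    setOf_two_le_natIndicator, measureReal_empty, Nat.cast_one, one_mul, sub_zero] at key
  have hm1 : m ^ (1 / p.toReal) * m ^ (1 / p.conjExponent.toReal) = m := by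
    rw [← Real.rpow_add hmpos, one_div, one_div, hP.inv_add_inv_eq_one, Real.rpow_one]
  calc a * y ≤ ENNReal.ofReal (m ^ (1 / p.toReal)) * ENNReal.ofReal l := by
        rw [hly]
        gcongr
        refine ha.le.trans (ENNReal.ofReal_le_ofReal ?_)
        exact Real.rpow_le_rpow ht.le htm.le (by positivity)
    _ = p.conjExponent * ENNReal.ofReal (l * (1 / G) * m) := by
        rw [← ENNReal.ofReal_toReal hq, ← ENNReal.ofReal_mul (by positivity),
          ← ENNReal.ofReal_mul (by positivity)]
        congr 1
        nth_rewrite 2 [← hm1]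
        rw [hG]
        field_simp
    _ ≤ _ := by gcongr

lemma lorentzNorm_le_dualNorm {f : R → ℝ} {p s : ℝ≥0∞} (hp : 1 < p) (hps : p < s)
    (hf : MemLorentz f p s μ) :
    lorentzNorm f p s μ ≤ lorentzConst p s * dualNorm f p s μ := by
  by_cases hs : s = ∞
  · subst hs
    exact lorentzNorm_le_dualNorm_top hp hps.ne hf
  · exact lorentzNorm_le_dualNorm_of_ne_top hp hps hs hf

lemma memLorentz_indicator {E : Set R} (hEm : MeasurableSet E) (hE : μ E ≠ ∞) {p s : ℝ≥0∞}
    (hp : 1 < p) (hps : p < s) : MemLorentz (E.indicator 1) p s μ := by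
  have hp' : p ≠ ∞ := (hps.trans_le le_top).ne
  have hp0 : p ≠ 0 := (zero_lt_one.trans hp).ne'
  refine ⟨(measurable_one.indicator hEm).aestronglyMeasurable, ?_⟩
  have hs0 : s ≠ 0 := (zero_lt_one.trans (hp.trans hps)).ne'
  rw [lorentzNorm_indicator hE hp' hp0 hs0]
  exact ENNReal.mul_lt_top (ENNReal.rpow_lt_top_of_nonneg ENNReal.toReal_nonneg
    (ENNReal.div_ne_top hp' hs0)) ENNReal.ofReal_lt_top

lemma lorentzNorm_indicator_pos {E : Set R} (hE : μ E ≠ ∞) (hE0 : μ E ≠ 0) {p s : ℝ≥0∞}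
    (hp : 1 < p) (hps : p < s) : 0 < lorentzNorm (E.indicator 1) p s μ := by
  have hp' : p ≠ ∞ := (hps.trans_le le_top).ne
  have hp0 : p ≠ 0 := (zero_lt_one.trans hp).ne'
  have hs0 : s ≠ 0 := (zero_lt_one.trans (hp.trans hps)).ne'
  have hmpos : 0 < μ.real E := ENNReal.toReal_pos hE0 hE
  rw [lorentzNorm_indicator hE hp' hp0 hs0]
  refine ENNReal.mul_pos ?_ (ENNReal.ofReal_pos.2 (by positivity)).ne'
  by_cases hs : s = ∞
  · simp [hs]
  · exact (ENNReal.rpow_pos (ENNReal.div_pos hp0 hs)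
      (ENNReal.div_ne_top hp' hs0)).ne'

/-- The second factor of `c_{p,s}` cancels against `(s'/p')^(1/s')` from the dual bound; what
remains is the Lorentz functional of the indicator. -/
lemma lorentzConst_mul_dualNorm_indicator_le {E : Set R} (hEm : MeasurableSet E) (hE : μ E ≠ ∞)
    (hE0 : μ E ≠ 0) {p s : ℝ≥0∞} (hp : 1 < p) (hps : p < s) :
    lorentzConst p s * dualNorm (E.indicator 1) p s μ ≤ lorentzNorm (E.indicator 1) p s μ := by
  have hp' : p ≠ ∞ := (hps.trans_le le_top).ne
  have hs1 := hp.trans hps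
  have hq := conjExponent_ne_top hp
  have hr := conjExponent_ne_top hs1
  have hP' := ENNReal.toReal_pos (conjExponent_ne_zero p) hq
  have hS' := ENNReal.toReal_pos (conjExponent_ne_zero s) hr
  refine (mul_le_mul_right (dualNorm_indicator_le hEm hE hE0 hp hps) _).trans_eq ?_
  rw [lorentzNorm_indicator hE hp' (zero_lt_one.trans hp).ne' (zero_lt_one.trans hs1).ne',
    lorentzConst, mul_assoc, ENNReal.ofReal_mul (by positivity)]
  congr 1
  rw [← mul_assoc]
  refine (congrArg (· * _) ?_).trans (one_mul _)
  rw [one_div, one_div, ENNReal.toReal_inv, ← ENNReal.ofReal_rpow_of_pos (by positivity),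
    ENNReal.ofReal_div_of_pos hP', ENNReal.ofReal_toReal hq, ENNReal.ofReal_toReal hr,
    ← ENNReal.mul_rpow_of_nonneg _ _ (by positivity), ← mul_div_assoc,
    ENNReal.div_mul_cancel (conjExponent_ne_zero s) hr,
    ENNReal.div_self (conjExponent_ne_zero p) hq, ENNReal.one_rpow]

lemma lorentzConst_le_of_forall [SigmaFinite μ] (hμ : μ ≠ 0) {p s : ℝ≥0∞} (hp : 1 < p)
    (hps : p < s) {C : ℝ≥0∞} (hC : ∀ f : R → ℝ, MemLorentz f p s μ →
      lorentzNorm f p s μ ≤ C * dualNorm f p s μ) : lorentzConst p s ≤ C := by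
  obtain ⟨E, hEm, -, hE0, hE⟩ := Measure.exists_subset_measure_lt_top (μ := μ) (r := 0)
    MeasurableSet.univ (Measure.measure_univ_pos.2 hμ)
  have hmem := memLorentz_indicator hEm hE.ne hp hps
  have h1 := lorentzConst_mul_dualNorm_indicator_le hEm hE.ne hE0.ne' hp hps
  have h2 := hC _ hmem
  have hpos := lorentzNorm_indicator_pos hE.ne hE0.ne' hp hps
  -- Cancelling the dual norm in `[0, ∞]` requires it to be neither `0` nor `∞`.
  have hd : dualNorm (E.indicator 1) p s μ ≠ 0 := fun h => by
    rw [h, mul_zero] at h2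
    exact hpos.not_ge h2
  have hd' : dualNorm (E.indicator 1) p s μ ≠ ∞ := ne_top_of_le_ne_top ENNReal.ofReal_ne_top
    (dualNorm_indicator_le hEm hE.ne hE0.ne' hp hps)
  exact (ENNReal.mul_le_mul_iff_left hd hd').1 (h1.trans h2)

end

end LorentzSpace

theorem mainTheorem3 (p s : ENNReal) (hp : 1 < p) (hps : p < s) :
    -- on every nonatomic sigma-finite measure space: the inequality holds, and its constant is
    -- the least possible one as soon as the measure is not zero
    (∀ (R : Type u) [MeasurableSpace R] (μ : MeasureTheory.Measure R)
        [MeasureTheory.SigmaFinite μ], LorentzSpace.IsNonatomic μ →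
      (∀ f : R → ℝ, LorentzSpace.MemLorentz f p s μ →
        LorentzSpace.lorentzNorm f p s μ ≤
          LorentzSpace.lorentzConst p s * LorentzSpace.dualNorm f p s μ) ∧
      (μ ≠ 0 → ∀ C : ENNReal,
        (∀ f : R → ℝ, LorentzSpace.MemLorentz f p s μ →
          LorentzSpace.lorentzNorm f p s μ ≤ C * LorentzSpace.dualNorm f p s μ) →
        LorentzSpace.lorentzConst p s ≤ C)) ∧
    -- equality for the indicator function of `[0,1]` on the half-line with Lebesgue measure
    (LorentzSpace.MemLorentz ((Set.Icc (0 : ℝ) 1).indicator 1) p s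
        (MeasureTheory.volume.restrict (Set.Ioi 0)) ∧
      0 < LorentzSpace.lorentzNorm ((Set.Icc (0 : ℝ) 1).indicator 1) p s
        (MeasureTheory.volume.restrict (Set.Ioi 0)) ∧
      LorentzSpace.lorentzNorm ((Set.Icc (0 : ℝ) 1).indicator 1) p s
          (MeasureTheory.volume.restrict (Set.Ioi 0)) =
        LorentzSpace.lorentzConst p s *
          LorentzSpace.dualNorm ((Set.Icc (0 : ℝ) 1).indicator 1) p s
            (MeasureTheory.volume.restrict (Set.Ioi 0))) := by
  refine ⟨fun R _ μ _ _ => ⟨fun f hf => LorentzSpace.lorentzNorm_le_dualNorm hp hps hf,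
    fun hμ C hC => LorentzSpace.lorentzConst_le_of_forall hμ hp hps hC⟩, ?_⟩
  have hE : (volume.restrict (Set.Ioi (0 : ℝ))) (Set.Icc (0 : ℝ) 1) = 1 := by
    have : (Set.Icc (0 : ℝ) 1 ∩ Set.Ioi 0) = Set.Ioc 0 1 := by
      ext x
      simp only [Set.mem_inter_iff, Set.mem_Icc, Set.mem_Ioi, Set.mem_Ioc]
      exact ⟨fun h => ⟨h.2, h.1.2⟩, fun h => ⟨⟨h.1.le, h.2⟩, h.1⟩⟩
    rw [Measure.restrict_apply measurableSet_Icc, this]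
    simp
  have hE1 : (volume.restrict (Set.Ioi (0 : ℝ))) (Set.Icc (0 : ℝ) 1) ≠ ∞ := by simp [hE]
  have hE0 : (volume.restrict (Set.Ioi (0 : ℝ))) (Set.Icc (0 : ℝ) 1) ≠ 0 := by simp [hE]
  have hmem := LorentzSpace.memLorentz_indicator measurableSet_Icc hE1 hp hps
  exact ⟨hmem, LorentzSpace.lorentzNorm_indicator_pos hE1 hE0 hp hps,
    le_antisymm (LorentzSpace.lorentzNorm_le_dualNorm hp hps hmem)
      (LorentzSpace.lorentzConst_mul_dualNorm_indicator_le measurableSet_Icc hE1 hE0 hp hps)⟩
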